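/- Let $m,n\ge 1$ be integers. Let $\mathcal A=\mathcal A_{(m,1^n)}$ be a configuration of vectors $\alpha_0,\alpha_1,\dots,\alpha_n\in\mathbb C^2$ with multiplicities $m_0=m$ and $m_1=\dots=m_n=1$, such that $\alpha_0=(1,0)$, $\alpha_j=(\cos\varphi_j,\sin\varphi_j)$ with $\varphi_j\in\mathbb C$ for $1\le j\le n$, and for each $1\le i\le n$ the $i$-th elementary symmetric polynomial $e_i$ in the numbers $z_j=e^{2\sqrt{-1}\,\varphi_j}$, $1\le j\le n$, equals $$e_i=(-1)^i\binom{n}{i}\binom{m+i-1}{i}\binom{m+n-1}{i}^{-1}.$$ Let $Q_{\mathcal A}\subset\mathbb C[x_1,x_2]$ be the algebra of quasi-invariants of $\mathcal A$, that is, of the polynomials $p$ such that for all $0\le j\le n$ and $1\le s\le m_j$ the polynomial $\partial_{\alpha_j}^{2s-1}p$ vanishes on the line $(\alpha_j,x)=0$, where $(\cdot,\cdot)$ is the standard bilinear form on $\mathbb C^2$ and $\partial_{\alpha}=(\alpha,\partial/\partial x)$. Let $P(t)=\sum_{k\ge 0}b_kt^k$ be its Hilbert series, where $b_k$ is the dimension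 of the space of homogeneous elements of $Q_{\mathcal A}$ of degree $k$. Then $$P(t)=\frac{1-t^2+t^{n+1}+t^{n+2}+t^{2m+n}+t^{2m+n+1}-t^{2m+2n}+t^{2m+2n+2}}{(t^2-1)^2}.$$ Moreover, this series is palindromic, i.e. $P(t^{-1})=t^{M}P(t)$ as rational functions for some $M\in\mathbb Z$, and the ring $Q_{\mathcal A}$ is Gorenstein (it is Noetherian and each of its localizations at a prime ideal has finite injective dimension as a module over itself). -/

import Mathlib

/-- A finite family `α₀, …, αₙ` of vectors of `ℂ²` with multiplicities `m₀, …, mₙ`. -/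
structure PlaneConfiguration (n : ℕ) where
  vec : Fin (n + 1) → Fin 2 → ℂ
  mult : Fin (n + 1) → ℕ

/-- The directional derivative `∂_α = α₁ ∂/∂x₁ + α₂ ∂/∂x₂` on `ℂ[x₁, x₂]`. -/
noncomputable def dirDeriv (α : Fin 2 → ℂ) :
    Derivation ℂ (MvPolynomial (Fin 2) ℂ) (MvPolynomial (Fin 2) ℂ) :=
  ∑ j, α j • MvPolynomial.pderiv j

/-- If the derivatives of `p` and `q` of the wrong parity vanish at a point (up to order `k`),
then so does the `k`-th derivative of `p * q` when `k` has the wrong parity. -/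
theorem eval_iterate_dirDeriv_mul (α x : Fin 2 → ℂ) (k : ℕ) :
    ∀ (a b : ℕ) (p q : MvPolynomial (Fin 2) ℂ),
      (∀ j ≤ k, Odd (j + a) → MvPolynomial.eval x ((dirDeriv α)^[j] p) = 0) →
      (∀ j ≤ k, Odd (j + b) → MvPolynomial.eval x ((dirDeriv α)^[j] q) = 0) →
      Odd (k + (a + b)) → MvPolynomial.eval x ((dirDeriv α)^[k] (p * q)) = 0 := by
  induction k with
  | zero =>
    intro a b p q hp hq h
    rw [Function.iterate_zero, id, map_mul]
    rcases Nat.even_or_odd a with ha | ha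
    · have hb : Odd (0 + b) := by
        rw [Nat.odd_iff] at *; rw [Nat.even_iff] at ha; omega
      have := hq 0 le_rfl hb
      rw [Function.iterate_zero, id] at this
      rw [this, mul_zero]
    · have := hp 0 le_rfl (by rwa [Nat.zero_add])
      rw [Function.iterate_zero, id] at this
      rw [this, zero_mul]
  | succ k ih =>
    intro a b p q hp hq h
    rw [Function.iterate_succ_apply, Derivation.leibniz, smul_eq_mul, smul_eq_mul,
      iterate_map_add, map_add]
    rw [ih a (b + 1) p (dirDeriv α q) (fun j hj => hp j (by omega)) ?_ ?_,
      ih b (a + 1) q (dirDeriv α p) (fun j hj => hq j (by omega)) ?_ ?_, add_zero]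
    · intro j hj hjo
      rw [← Function.iterate_succ_apply]
      refine hp (j + 1) (by omega) ?_
      rw [Nat.odd_iff] at *; omega
    · rw [Nat.odd_iff] at *; omega
    · intro j hj hjo
      rw [← Function.iterate_succ_apply]
      refine hq (j + 1) (by omega) ?_
      rw [Nat.odd_iff] at *; omega
    · rw [Nat.odd_iff] at *; omega

namespace PlaneConfiguration

variable {n : ℕ}

/-- `p` is quasi-invariant: for every vector `α` of multiplicity `m_α` and `1 ≤ s ≤ m_α`, the
polynomial `∂_α^(2s-1) p` vanishes on the line `(α, x) = 0`. Here `(α, x) = α₁ x₁ + α₂ x₂`. -/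
def IsQuasiInvariant (A : PlaneConfiguration n) (p : MvPolynomial (Fin 2) ℂ) : Prop :=
  ∀ i : Fin (n + 1), ∀ s : ℕ, 1 ≤ s → s ≤ A.mult i →
    ∀ x : Fin 2 → ℂ, A.vec i ⬝ᵥ x = 0 →
      MvPolynomial.eval x ((dirDeriv (A.vec i))^[2 * s - 1] p) = 0

/-- The algebra of quasi-invariants, as a subalgebra of `ℂ[x₁, x₂]`. -/
def quasiInvariants (A : PlaneConfiguration n) : Subalgebra ℂ (MvPolynomial (Fin 2) ℂ) where
  carrier := {p | A.IsQuasiInvariant p}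
  mul_mem' := by
    intro p q hp hq i s hs hsm x hx
    have key : ∀ r : MvPolynomial (Fin 2) ℂ, A.IsQuasiInvariant r →
        ∀ j ≤ 2 * s - 1, Odd (j + 0) →
          MvPolynomial.eval x ((dirDeriv (A.vec i))^[j] r) = 0 := by
      rintro r hr j hj ⟨t, ht⟩
      have := hr i (t + 1) (by omega) (by omega) x hx
      rwa [show 2 * (t + 1) - 1 = j by omega] at this
    exact eval_iterate_dirDeriv_mul (A.vec i) x (2 * s - 1) 0 0 p q (key p hp) (key q hq)
      ⟨s - 1, by omega⟩
  add_mem' := by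
    intro p q hp hq i s hs hsm x hx
    rw [iterate_map_add, map_add, hp i s hs hsm x hx, hq i s hs hsm x hx, add_zero]
  algebraMap_mem' := by
    intro c i s hs _ x _
    obtain ⟨t, ht⟩ : ∃ t, 2 * s - 1 = t + 1 := ⟨2 * s - 2, by omega⟩
    rw [ht, Function.iterate_succ_apply, Derivation.map_algebraMap, iterate_map_zero, map_zero]

/-- The space of homogeneous quasi-invariants of degree `k`. -/
noncomputable def homogeneousQuasiInvariants (A : PlaneConfiguration n) (k : ℕ) :
    Submodule ℂ (MvPolynomial (Fin 2) ℂ) :=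
  Subalgebra.toSubmodule A.quasiInvariants ⊓ MvPolynomial.homogeneousSubmodule (Fin 2) ℂ k

/-- The Hilbert series `∑ₖ bₖ tᵏ`, where `bₖ` is the dimension of the space of homogeneous
quasi-invariants of degree `k`. -/
noncomputable def hilbertSeries (A : PlaneConfiguration n) : PowerSeries ℚ :=
  PowerSeries.mk fun k => (Module.finrank ℂ (A.homogeneousQuasiInvariants k) : ℚ)

/-- The Hilbert series is (the expansion of) a rational function `P(t)` with
`P(t⁻¹) = t ^ M * P(t)` for some integer `M`. -/
def HasPalindromicHilbertSeries (A : PlaneConfiguration n) : Prop :=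
  ∃ P : RatFunc ℚ, A.hilbertSeries * (P.denom : PowerSeries ℚ) = (P.num : PowerSeries ℚ) ∧
    ∃ M : ℤ, P.eval RatFunc.C (RatFunc.X : RatFunc ℚ)⁻¹ = RatFunc.X ^ M * P

/-- `A` is the configuration `𝒜_(m,1ⁿ)`: the vector `α₀ = (1, 0)` has multiplicity `m`, the vectors
`αⱼ = (cos φⱼ, sin φⱼ)`, `1 ≤ j ≤ n`, have multiplicity `1`, and the `i`-th elementary symmetric
polynomial of the numbers `zⱼ = exp (2 √-1 φⱼ)`, `1 ≤ j ≤ n`, is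
`(-1)ⁱ C(n, i) C(m+i-1, i) / C(m+n-1, i)` for `1 ≤ i ≤ n`. -/
def IsAm1n (A : PlaneConfiguration n) (m : ℕ) : Prop :=
  A.vec 0 = ![1, 0] ∧ A.mult 0 = m ∧ (∀ j : Fin n, A.mult j.succ = 1) ∧
    ∃ φ : Fin n → ℂ, (∀ j : Fin n, A.vec j.succ = ![Complex.cos (φ j), Complex.sin (φ j)]) ∧
      ∀ i : ℕ, 1 ≤ i → i ≤ n →
        MvPolynomial.eval (fun j => Complex.exp (2 * Complex.I * φ j))
            (MvPolynomial.esymm (Fin n) ℂ i) =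
          (-1) ^ i * (n.choose i : ℂ) * ((m + i - 1).choose i : ℂ) / ((m + n - 1).choose i : ℂ)

end PlaneConfiguration

/-- A commutative ring `R` is Gorenstein if it is Noetherian and each of its localizations at a
prime ideal has finite injective dimension as a module over itself. -/
def IsGorensteinRing (R : Type*) [CommRing R] : Prop :=
  IsNoetherianRing R ∧ ∀ (p : Ideal R) [p.IsPrime], ∃ d : ℕ,
    CategoryTheory.HasInjectiveDimensionLE
      (ModuleCat.of (Localization.AtPrime p) (Localization.AtPrime p)) d

/-!
With `ρ = x₁² + x₂²` one has `ℂ[x₁, x₂] = ℂ[ρ, x₂] ⊕ x₁ ℂ[ρ, x₂]`, and `ℂ[ρ, x₂]` is modelled by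
`ℂ[X][X]` through `planeHom`, the inner variable being `ρ` and the outer one `X = x₂`.

The condition on the elementary symmetric polynomials says that `∏ⱼ (z - zⱼ)` is, for `z = e^{2iθ}`
and up to a unit, the Fourier expansion of the Gegenbauer polynomial of degree `n` with parameter
`m` at `cos θ` (`gegenbauer_eval_cos`). Hence the lines of multiplicity one form the zero set of
its homogenization `Γ ∈ ℂ[ρ][X]`, which satisfies the Gegenbauer equation
`(ρ - X²) Γ'' - (2m + 1) X Γ' + n (n + 2m) Γ = 0`.

Quasi-invariance along `x₁ = 0` means that `p = g + x₁^(2m+1) h` with `g, h ∈ ℂ[ρ, x₂]`. On the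
other lines `∂_α` is proportional to the angular derivative, and reflecting in `x₁` separates `g`
and `h`: the condition on `g` is `Γ ∣ g'`, and the condition on `h` is
`Γ ∣ (2m + 1) X h - (ρ - X²) h'`. By the Gegenbauer equation the latter is `Γ ∣ Γ'' h - Γ' h'`,
that is, `h / Γ²` has no residues (`PlaneConfiguration.mem_quasiInvariants_iff`). So the
`g` are the antiderivatives of multiples of `Γ`, of degree in `X` either `0` or at least `n + 1`.
For a fixed nonzero `ρ`, the `h` of degree less than `2n` are Wronskians of `Γ`, and the degrees that occur are all `d ≥ n - 1`
except `2n - 1`. Both spaces contain monic elements of all these degrees.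

Let `b` be the monic even element of degree `n + 1`. Comparing degrees in `X` modulo `n + 1`, the
quasi-invariants form a free module over `ℂ[ρ, b]` with even generators of degrees
`0, n + 2, …, 2n + 1` in `X` and odd generators of degrees `3n, 2n - 2, …, n - 1`
(`quasiInvariantBasis`). This gives the Hilbert series. The degrees of the even and of the odd
generators are complementary to `3n`; therefore the coordinate at the odd generator of degree `3n` is a
Frobenius form (`quasiInvariants_isGorensteinRing`). An algebra `R` that is finite and free over a polynomial ring
`S` in two variables and has a Frobenius form is isomorphic to `Hom_S(R, S)`, whose injective
dimension is at most two: over the base field coinduced modules are injective, and each variable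
raises the dimension by at most one (`isGorensteinRing_of_frobenius`).
-/

section Gorenstein

open scoped Polynomial

/-! ### Coinduced modules and a criterion for Gorenstein rings -/

/-- The coinduced module `Hom_A(R, N)` of an `A`-algebra `R`, with `R` acting by translation of the
argument. A structure and not `R →ₗ[A] N` itself, which may carry other actions of `R`. -/
@[ext]
structure Coinduced (A R N : Type*) [CommRing A] [CommRing R] [Algebra A R] [AddCommGroup N]
    [Module A N] where
  toLinearMap : R →ₗ[A] N

namespace Coinduced

section Basic

variable (A R N : Type*) [CommRing A] [CommRing R] [Algebra A R] [AddCommGroup N] [Module A N]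

/-- Elements of the coinduced module are linear maps. -/
def equivLinearMap : Coinduced A R N ≃ (R →ₗ[A] N) where
  toFun := toLinearMap
  invFun := mk

noncomputable instance : AddCommGroup (Coinduced A R N) :=
  (equivLinearMap A R N).addCommGroup

variable {A R N}

theorem ext_apply {f g : Coinduced A R N} (h : ∀ x, f.toLinearMap x = g.toLinearMap x) : f = g :=
  Coinduced.ext (LinearMap.ext h)

theorem zero_apply (x : R) : (0 : Coinduced A R N).toLinearMap x = 0 := rfl

theorem add_apply (f g : Coinduced A R N) (x : R) :
    (f + g).toLinearMap x = f.toLinearMap x + g.toLinearMap x := rfl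

noncomputable instance : SMul R (Coinduced A R N) where
  smul r f := ⟨f.toLinearMap ∘ₗ LinearMap.mulLeft A r⟩

theorem smul_apply (r : R) (f : Coinduced A R N) (x : R) :
    (r • f).toLinearMap x = f.toLinearMap (r * x) := rfl

noncomputable instance : Module R (Coinduced A R N) where
  one_smul f := ext_apply fun x => by rw [smul_apply, one_mul]
  mul_smul r s f := ext_apply fun x => by simp only [smul_apply]; congr 1; ring
  smul_zero r := ext_apply fun x => by simp only [smul_apply, zero_apply]
  smul_add r f g := ext_apply fun x => by simp only [smul_apply, add_apply]
  add_smul r s f := ext_apply fun x => by simp only [smul_apply, add_apply, add_mul, map_add]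
  zero_smul f := ext_apply fun x => by rw [smul_apply, zero_mul, map_zero, zero_apply]

end Basic

/-- Over a field `Hom_k(R, N)` is injective: a map `X → Hom_k(R, N)` is the same as a `k`-linear
map `X → N`, and these extend from subspaces. -/
theorem injective_of_field (k R N : Type*) [Field k] [CommRing R] [Algebra k R] [AddCommGroup N]
    [Module k N] : Module.Injective R (Coinduced k R N) where
  out X Y _ _ _ _ f hf g := by
    let _ : Module k X := Module.compHom X (algebraMap k R)
    let _ : Module k Y := Module.compHom Y (algebraMap k R)
    have hkX : ∀ (c : k) (x : X), c • x = algebraMap k R c • x := fun _ _ => rfl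
    have hkY : ∀ (c : k) (x : Y), c • x = algebraMap k R c • x := fun _ _ => rfl
    let f' : X →ₗ[k] Y :=
      { toFun := f, map_add' := map_add f, map_smul' := fun c x => map_smul f _ x }
    let g' : X →ₗ[k] N :=
      { toFun := fun x => (g x).toLinearMap 1
        map_add' := fun x y => by rw [map_add]; rfl
        map_smul' := fun c x => by
          rw [hkX, map_smul, smul_apply, mul_one, Algebra.algebraMap_eq_smul_one, map_smul]; rfl }
    obtain ⟨p, hp⟩ := f'.exists_leftInverse_of_injective (LinearMap.ker_eq_bot.mpr hf)
    let h : Y →ₗ[k] N := g' ∘ₗ p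
    have hh : ∀ x, h (f x) = (g x).toLinearMap 1 := fun x =>
      congrArg g' (LinearMap.congr_fun hp x)
    refine ⟨{ toFun := fun y => ⟨{ toFun := fun r => h (r • y)
                                   map_add' := fun r s => by rw [add_smul, map_add]
                                   map_smul' := fun c r => by
                                     rw [Algebra.smul_def, mul_smul, ← hkY, map_smul]; rfl }⟩
              map_add' := fun y z => ext_apply fun r => by
                change h (r • (y + z)) = h (r • y) + h (r • z)
                rw [smul_add, map_add]
              map_smul' := fun s y => ext_apply fun r => by
                change h (r • s • y) = h ((s * r) • y)
                rw [smul_smul, mul_comm] }, fun x => ext_apply fun r => ?_⟩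
    change h (r • f x) = (g x).toLinearMap r
    rw [← map_smul, hh, map_smul, smul_apply, mul_one]

section Polynomial

variable {A R N : Type*} [CommRing A] [CommRing R] [Algebra A R] [Algebra A[X] R]
  [AddCommGroup N] [Module A N] [Module A[X] N] [IsScalarTower A A[X] N]

variable (A R N) in
/-- The map `f ↦ f (X ·) - X f`, whose kernel consists of the `A[X]`-linear maps. -/
noncomputable def commutatorX : Coinduced A R N →ₗ[R] Coinduced A R N where
  toFun f := ⟨f.toLinearMap ∘ₗ LinearMap.mulLeft A (algebraMap A[X] R Polynomial.X) -
    (LinearMap.lsmul A[X] N Polynomial.X).restrictScalars A ∘ₗ f.toLinearMap⟩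
  map_add' f g := ext_apply fun x => by
    change (f.toLinearMap _ + g.toLinearMap _) -
        (Polynomial.X : A[X]) • (f.toLinearMap x + g.toLinearMap x)
      = (f.toLinearMap _ - (Polynomial.X : A[X]) • f.toLinearMap x) +
        (g.toLinearMap _ - (Polynomial.X : A[X]) • g.toLinearMap x)
    rw [smul_add]; abel
  map_smul' r f := ext_apply fun x => by
    change f.toLinearMap (r * (algebraMap A[X] R Polynomial.X * x)) -
        (Polynomial.X : A[X]) • f.toLinearMap (r * x) =
      f.toLinearMap (algebraMap A[X] R Polynomial.X * (r * x)) -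
        (Polynomial.X : A[X]) • f.toLinearMap (r * x)
    rw [mul_left_comm]

theorem commutatorX_apply (f : Coinduced A R N) (x : R) :
    (commutatorX A R N f).toLinearMap x =
      f.toLinearMap ((Polynomial.X : A[X]) • x) - (Polynomial.X : A[X]) • f.toLinearMap x := by
  rw [Algebra.smul_def]; rfl

variable [IsScalarTower A A[X] R]

variable (A R N) in
/-- Restriction of scalars from `A[X]`-linear to `A`-linear maps. -/
noncomputable def restrictPolynomial : Coinduced A[X] R N →ₗ[R] Coinduced A R N where
  toFun f := ⟨f.toLinearMap.restrictScalars A⟩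
  map_add' _ _ := rfl
  map_smul' _ _ := rfl

theorem restrictPolynomial_injective : Function.Injective (restrictPolynomial A R N) :=
  fun _ _ h => ext_apply fun x => congrArg (fun f => f.toLinearMap x) h

theorem exact_restrictPolynomial_commutatorX :
    Function.Exact (restrictPolynomial A R N) (commutatorX A R N) := by
  intro f
  constructor
  · intro hf
    have hX : ∀ x, f.toLinearMap ((Polynomial.X : A[X]) • x) =
        (Polynomial.X : A[X]) • f.toLinearMap x := fun x => by
      rw [← sub_eq_zero, ← commutatorX_apply, hf, zero_apply]
    refine ⟨⟨{ toFun := f.toLinearMap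
               map_add' := map_add f.toLinearMap
               map_smul' := fun p x => ?_ }⟩, rfl⟩
    rw [RingHom.id_apply]
    induction p using Polynomial.induction_on' generalizing x with
    | add p q hp hq => rw [add_smul, map_add, hp, hq, add_smul]
    | monomial n a =>
      rw [← Polynomial.smul_X_eq_monomial]
      induction n generalizing x with
      | zero => simp
      | succ n ih => rw [pow_succ, ← smul_mul_assoc, mul_smul, ih, hX, mul_smul]
  · rintro ⟨g, rfl⟩
    refine ext_apply fun x => ?_
    rw [commutatorX_apply, zero_apply]
    exact sub_eq_zero.mpr (map_smul g.toLinearMap _ _)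

/-- If `R` is free over `A[X]` with basis `c`, then `X ^ n • c i` is a basis over `A`, and the
equation `f (X x) = X f x + g x` is solved recursively on it. -/
theorem commutatorX_surjective [Module.Free A[X] R] :
    Function.Surjective (commutatorX A R N) := by
  intro g
  let c := Module.Free.chooseBasis A[X] R
  let F : ℕ → Module.Free.ChooseBasisIndex A[X] R → N := fun n i =>
    Nat.rec (motive := fun _ => N) 0
      (fun n y => (Polynomial.X : A[X]) • y + g.toLinearMap ((Polynomial.X ^ n : A[X]) • c i)) n
  let B := (Polynomial.basisMonomials A).smulTower c
  have hB : ∀ n i, B (n, i) = (Polynomial.X ^ n : A[X]) • c i := fun n i => by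
    rw [Module.Basis.smulTower_apply, Polynomial.coe_basisMonomials, Polynomial.X_pow_eq_monomial]
  let f : R →ₗ[A] N := B.constr ℕ fun p => F p.1 p.2
  have hf : ∀ n i, f ((Polynomial.X ^ n : A[X]) • c i) = F n i := fun n i => by
    rw [← hB, Module.Basis.constr_basis]
  refine ⟨⟨f⟩, Coinduced.ext (B.ext ?_)⟩
  rintro ⟨n, i⟩
  rw [commutatorX_apply, hB, smul_smul, ← pow_succ', hf, hf]
  exact add_sub_cancel_left _ _

end Polynomial

open CategoryTheory in
/-- Passing from `Hom_A(R, N)` to `Hom_{A[X]}(R, N)` raises the injective dimension by at most one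
when `R` is free over `A[X]`. -/
theorem hasInjectiveDimensionLE_polynomial {A R N : Type} [CommRing A] [CommRing R] [Algebra A R]
    [Algebra A[X] R] [IsScalarTower A A[X] R] [AddCommGroup N] [Module A N] [Module A[X] N]
    [IsScalarTower A A[X] N] [Module.Free A[X] R] (d : ℕ)
    (h : HasInjectiveDimensionLE (ModuleCat.of R (Coinduced A R N)) d) :
    HasInjectiveDimensionLE (ModuleCat.of R (Coinduced A[X] R N)) (d + 1) :=
  (ModuleCat.shortComplex_shortExact
    (ModuleCat.shortComplexOfCompEqZero (restrictPolynomial A R N) (commutatorX A R N)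
      exact_restrictPolynomial_commutatorX.linearMap_comp_eq_zero)
    exact_restrictPolynomial_commutatorX restrictPolynomial_injective
    commutatorX_surjective).hasInjectiveDimensionLT_X₁ (d + 1) h
    (hasInjectiveDimensionLT_of_ge _ (d + 1) (d + 1 + 1) (Nat.le_succ _))

end Coinduced

open CategoryTheory in
/-- A commutative algebra `R`, free of finite rank over a polynomial ring `S` in two variables over
a field and isomorphic as an `R`-module to its dual `Hom_S(R, S)`, is Gorenstein. -/
theorem isGorensteinRing_of_frobenius {k R : Type} [Field k] [CommRing R] [Algebra k[X][X] R]
    [Module.Free k[X][X] R] [Module.Finite k[X][X] R] (form : R →ₗ[k[X][X]] k[X][X])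
    (hform : Function.Bijective fun r : R => form ∘ₗ LinearMap.mulLeft k[X][X] r) :
    IsGorensteinRing R := by
  have hR : IsNoetherianRing R := IsNoetherianRing.of_finite k[X][X] R
  refine ⟨hR, fun p _ => ⟨2, ?_⟩⟩
  let _ : Algebra k[X] R := Algebra.compHom R (algebraMap k[X] k[X][X])
  have : IsScalarTower k[X] k[X][X] R := IsScalarTower.of_algebraMap_eq fun _ => rfl
  let _ : Algebra k R := Algebra.compHom R (algebraMap k k[X])
  have : IsScalarTower k k[X] R := IsScalarTower.of_algebraMap_eq fun _ => rfl
  have : Module.Free k[X] R := Module.Free.trans (R := k[X]) (S := k[X][X]) (M := R)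
  have h0 : HasInjectiveDimensionLE (ModuleCat.of R (Coinduced k R k[X][X])) 0 := by
    have := Coinduced.injective_of_field k R k[X][X]
    have : Injective (ModuleCat.of R (Coinduced k R k[X][X])) :=
      Module.injective_object_of_injective_module R _
    exact inferInstanceAs (HasInjectiveDimensionLT _ 1)
  have h2 := Coinduced.hasInjectiveDimensionLE_polynomial 1
    (Coinduced.hasInjectiveDimensionLE_polynomial 0 h0)
  let e : R ≃ₗ[R] Coinduced k[X][X] R k[X][X] := LinearEquiv.ofBijective
    { toFun := fun r => ⟨form ∘ₗ LinearMap.mulLeft k[X][X] r⟩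
      map_add' := fun r s => Coinduced.ext_apply fun x => by
        change form ((r + s) * x) = form (r * x) + form (s * x)
        rw [add_mul, map_add]
      map_smul' := fun r s => Coinduced.ext_apply fun x => by
        change form (r * s * x) = form (s * (r * x))
        congr 1; ring }
    ((Coinduced.equivLinearMap k[X][X] R k[X][X]).symm.bijective.comp hform)
  have : HasInjectiveDimensionLE (ModuleCat.of R R) 2 :=
    (ModuleCat.hasInjectiveDimensionLE_iff_of_linearEquiv
      (M := ModuleCat.of R R) (N := ModuleCat.of R (Coinduced k[X][X] R k[X][X])) e 2).mpr h2
  have hloc := (ModuleCat.of R R).localizedModule_hasInjectiveDimensionLE 2 p.primeCompl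
  refine (ModuleCat.hasInjectiveDimensionLE_iff_of_linearEquiv
    (M := ModuleCat.of (Localization.AtPrime p) (Localization.AtPrime p))
    (N := (ModuleCat.of R R).localizedModule p.primeCompl) ?_ 2).mpr hloc
  have := (ModuleCat.of R R).localizedModule_isLocalizedModule p.primeCompl
  exact LinearEquiv.extendScalarsOfIsLocalization p.primeCompl (Localization.AtPrime p)
    (IsLocalizedModule.linearEquiv p.primeCompl
      (Algebra.linearMap R (Localization.AtPrime p))
      ((ModuleCat.of R R).localizedModuleMkLinearMap p.primeCompl))

section PerfectPairing

/-- A linear form whose Gram matrix on a basis consists of two antidiagonal blocks, transposes of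
each other and unitriangular, induces a perfect pairing. -/
theorem bijective_comp_mulLeft {S R ι : Type*} [CommRing S] [CommRing R] [Algebra S R] [Fintype ι]
    [LinearOrder ι] (u : Module.Basis (ι ⊕ ι) S R) (form : R →ₗ[S] S)
    (hl : ∀ i j, form (u (.inl i) * u (.inl j)) = 0)
    (hr : ∀ i j, form (u (.inr i) * u (.inr j)) = 0)
    (hlt : ∀ i j, i < j → form (u (.inl i) * u (.inr j)) = 0)
    (hdiag : ∀ i, form (u (.inl i) * u (.inr i)) = 1) :
    Function.Bijective fun r : R => form ∘ₗ LinearMap.mulLeft S r := by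
  let B : R →ₗ[S] Module.Dual S R := form.compRight S ∘ₗ LinearMap.mul S R
  let M : Matrix ι ι S := Matrix.of fun i j => form (u (.inl i) * u (.inr j))
  have hM : IsUnit M.det := by
    rw [Matrix.det_of_isLowerTriangular (M := M) fun i j hij => hlt i j hij]
    simp [M, hdiag]
  have hB : LinearMap.toMatrix u u.dualBasis B = Matrix.fromBlocks 0 M M.transpose 0 := by
    ext i j
    rw [LinearMap.toMatrix_apply, Module.Basis.dualBasis_repr]
    change form (u j * u i) = _
    rcases i with i | i <;> rcases j with j | j
    · exact hl j i
    · rw [mul_comm]; rfl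
    · rfl
    · exact hr j i
  have hunit : IsUnit (LinearMap.toMatrix u u.dualBasis B).det := by
    rw [hB]
    refine Matrix.isUnit_det_of_right_inverse (B := Matrix.fromBlocks 0 M.transpose⁻¹ M⁻¹ 0) ?_
    rw [Matrix.fromBlocks_multiply]
    simp [Matrix.mul_nonsing_inv _ hM,
      Matrix.mul_nonsing_inv M.transpose (by rwa [Matrix.det_transpose])]
  exact (LinearEquiv.ofIsUnitDet hunit).bijective

end PerfectPairing

end Gorenstein

section QuasiInvariants

open Polynomial

/-! ### Echelon bases over a polynomial subring -/

section Echelon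

variable {K ι : Type*} [CommRing K] [IsDomain K] [Fintype ι] {b : K[X]} {e : ι → K[X]}

theorem natDegree_comp_mul_of_monic {s b e : K[X]} (he : e.Monic) (hs : s ≠ 0)
    (hbN : b.natDegree ≠ 0) :
    (s.comp b * e).natDegree = s.natDegree * b.natDegree + e.natDegree := by
  rw [natDegree_mul _ he.ne_zero, natDegree_comp]
  intro h
  rcases comp_eq_zero_iff.mp h with h | ⟨-, h⟩
  · exact hs h
  · exact hbN (by rw [h, natDegree_C])

/-- If the degrees of the monic polynomials `e i` are distinct modulo the degree of `b`, no
cancellation of leading terms occurs in a combination `∑ sᵢ(b) eᵢ`. -/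
theorem degree_sum_comp_mul (he : ∀ i, (e i).Monic) (hbN : b.natDegree ≠ 0)
    (hinj : ∀ i j, (e i).natDegree ≡ (e j).natDegree [MOD b.natDegree] → i = j) (s : ι → K[X]) :
    (∑ i, (s i).comp b * e i).degree = Finset.univ.sup fun i => ((s i).comp b * e i).degree := by
  refine degree_sum_eq_of_disjoint _ _ ?_
  rintro i ⟨-, hi⟩ j ⟨-, hj⟩ hij h
  have hsi : s i ≠ 0 := fun h0 => hi (by rw [h0, zero_comp, zero_mul])
  have hsj : s j ≠ 0 := fun h0 => hj (by rw [h0, zero_comp, zero_mul])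
  have h' := natDegree_eq_of_degree_eq h
  rw [natDegree_comp_mul_of_monic (he i) hsi hbN,
    natDegree_comp_mul_of_monic (he j) hsj hbN] at h'
  refine hij (hinj i j ?_)
  have h2 : (s i).natDegree * b.natDegree + (e i).natDegree ≡
      (s j).natDegree * b.natDegree + (e j).natDegree [MOD b.natDegree] := by rw [h']
  simpa [Nat.ModEq] using h2

theorem eq_zero_of_sum_comp_mul_eq_zero (he : ∀ i, (e i).Monic) (hbN : b.natDegree ≠ 0)
    (hinj : ∀ i j, (e i).natDegree ≡ (e j).natDegree [MOD b.natDegree] → i = j) {s : ι → K[X]}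
    (h : ∑ i, (s i).comp b * e i = 0) : s = 0 := by
  funext i
  by_contra hs
  have h1 := degree_sum_comp_mul he hbN hinj s
  rw [h, degree_zero] at h1
  have h2 : ((s i).comp b * e i).degree ≤ ⊥ :=
    h1 ▸ Finset.le_sup (f := fun i => ((s i).comp b * e i).degree) (Finset.mem_univ i)
  rw [le_bot_iff, degree_eq_bot] at h2
  rcases mul_eq_zero.mp h2 with h3 | h3
  · rcases comp_eq_zero_iff.mp h3 with h | ⟨-, h⟩
    · exact hs h
    · exact hbN (by rw [h, natDegree_C])
  · exact (he i).ne_zero h3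

/-- A coefficient of a combination `∑ sᵢ(b) eᵢ` of too small a degree vanishes. -/
theorem coeff_eq_zero_of_degree_sum_lt (he : ∀ i, (e i).Monic) (hbN : b.natDegree ≠ 0)
    (hinj : ∀ i j, (e i).natDegree ≡ (e j).natDegree [MOD b.natDegree] → i = j) (s : ι → K[X])
    (i : ι) (h : (∑ i, (s i).comp b * e i).degree < (e i).natDegree) : s i = 0 := by
  by_contra hs
  have h2 : ((s i).comp b * e i).degree ≤ (∑ i, (s i).comp b * e i).degree := by
    rw [degree_sum_comp_mul he hbN hinj s]
    exact Finset.le_sup (f := fun i => ((s i).comp b * e i).degree) (Finset.mem_univ i)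
  have h3 := h2.trans_lt h
  have h4 : (s i).comp b * e i ≠ 0 := by
    refine mul_ne_zero (fun h0 => ?_) (he i).ne_zero
    rcases comp_eq_zero_iff.mp h0 with h | ⟨-, h⟩
    · exact hs h
    · exact hbN (by rw [h, natDegree_C])
  rw [← natDegree_lt_iff_degree_lt h4, natDegree_comp_mul_of_monic (he i) hs hbN] at h3
  omega

/-- A monic combination `∑ sᵢ(b) eᵢ` of the degree of `e i` has coefficient `1` at `e i`. -/
theorem coeff_eq_one_of_monic_sum (he : ∀ i, (e i).Monic) (hbN : b.natDegree ≠ 0)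
    (hinj : ∀ i j, (e i).natDegree ≡ (e j).natDegree [MOD b.natDegree] → i = j) (s : ι → K[X])
    (i : ι) (hm : (∑ i, (s i).comp b * e i).Monic)
    (h : (∑ i, (s i).comp b * e i).natDegree = (e i).natDegree) : s i = 1 := by
  classical
  have h1 : ∑ j, ((s - Pi.single (M := fun _ => K[X]) i 1) j).comp b * e j =
      (∑ i, (s i).comp b * e i) - e i := by
    simp only [Pi.sub_apply, sub_comp, sub_mul, Finset.sum_sub_distrib]
    congr 1
    rw [Finset.sum_eq_single i (fun j _ hj => by rw [Pi.single_eq_of_ne hj, zero_comp, zero_mul])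
      (fun h => absurd (Finset.mem_univ i) h), Pi.single_eq_same, one_comp, one_mul]
  have h2 := coeff_eq_zero_of_degree_sum_lt he hbN hinj
    (s - Pi.single (M := fun _ => K[X]) i 1) i (by
    rw [h1, ← degree_eq_natDegree (he i).ne_zero]
    have hd : (∑ i, (s i).comp b * e i).degree = (e i).degree := by
      rw [degree_eq_natDegree hm.ne_zero, h, degree_eq_natDegree (he i).ne_zero]
    rw [← hd]
    exact degree_sub_lt_left hd hm.ne_zero (by rw [hm.leadingCoeff, (he i).leadingCoeff]))
  rw [Pi.sub_apply, Pi.single_eq_same] at h2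
  exact sub_eq_zero.mp h2

/-- A `K`-submodule of `K[X]` stable under a monic polynomial `b` is spanned over `K[b]` by monic
elements realizing all degrees of its elements up to multiples of the degree of `b`. -/
theorem exists_eq_sum_comp_mul (M : Submodule K K[X]) (hbm : b.Monic)
    (hb : ∀ p ∈ M, b * p ∈ M) (he : ∀ i, (e i).Monic) (heM : ∀ i, e i ∈ M)
    (hdeg : ∀ p ∈ M, p ≠ 0 → ∃ i q, p.natDegree = q * b.natDegree + (e i).natDegree)
    {p : K[X]} (hp : p ∈ M) : ∃ s : ι → K[X], p = ∑ i, (s i).comp b * e i := by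
  classical
  induction hd : p.degree using WellFoundedLT.induction generalizing p with
  | ind d ih =>
    subst hd
    by_cases hp0 : p = 0
    · exact ⟨0, by simp [hp0]⟩
    obtain ⟨i, q, hq⟩ := hdeg p hp hp0
    have hbq : ∀ r ∈ M, b ^ q * r ∈ M := by
      clear hq
      induction q with
      | zero => intro r hr; rwa [pow_zero, one_mul]
      | succ q ihq => intro r hr; rw [pow_succ', mul_assoc]; exact hb _ (ihq r hr)
    have hm : (b ^ q * e i).Monic := (hbm.pow q).mul (he i)
    have hmd : (b ^ q * e i).natDegree = p.natDegree := by
      rw [(hbm.pow q).natDegree_mul (he i), hbm.natDegree_pow, hq]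
    have hlc : p.leadingCoeff ≠ 0 := leadingCoeff_ne_zero.mpr hp0
    have hdeg' : (p.leadingCoeff • (b ^ q * e i)).degree = p.degree := by
      rw [smul_eq_C_mul, degree_C_mul hlc, degree_eq_natDegree hm.ne_zero, hmd,
        degree_eq_natDegree hp0]
    obtain ⟨s, hs⟩ := ih _ (degree_sub_lt_left hdeg'.symm hp0 (by
        rw [smul_eq_C_mul, leadingCoeff_mul, leadingCoeff_C, hm.leadingCoeff, mul_one]))
      (M.sub_mem hp (M.smul_mem p.leadingCoeff (hbq _ (heM i)))) rfl
    refine ⟨s + Pi.single i (C p.leadingCoeff * X ^ q), ?_⟩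
    simp only [Pi.add_apply, add_comp, add_mul, Finset.sum_add_distrib]
    rw [← hs, Finset.sum_eq_single i
      (fun j _ hj => by rw [Pi.single_eq_of_ne hj, zero_comp, zero_mul])
      (fun h => absurd (Finset.mem_univ i) h), Pi.single_eq_same, mul_comp, C_comp, X_pow_comp,
      smul_eq_C_mul]
    ring

end Echelon

/-! ### Wronskians and differentials without residues -/

section Wronskian

variable {K : Type*} [CommRing K]

theorem X_mul_derivative_coeff (f : K[X]) (n : ℕ) :
    (X * derivative f).coeff n = n * f.coeff n := by
  cases n with
  | zero => simp
  | succ n => rw [coeff_X_mul, coeff_derivative]; push_cast; ring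

theorem natDegree_X_mul_derivative_le {f : K[X]} {n : ℕ} (hf : f.natDegree ≤ n) :
    (X * derivative f).natDegree ≤ n := by
  rw [natDegree_le_iff_coeff_eq_zero] at hf ⊢
  intro j hj
  rw [X_mul_derivative_coeff, hf j hj, mul_zero]

theorem X_mul_wronskian (f v : K[X]) :
    X * wronskian f v = f * (X * derivative v) - X * derivative f * v := by
  rw [wronskian]; ring

/-- The top coefficient of a Wronskian; it vanishes when both degrees agree. -/
theorem wronskian_coeff {f v : K[X]} {n a d : ℕ} (hf : f.natDegree ≤ n) (hv : v.natDegree ≤ a)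
    (hd : d + 1 = n + a) :
    (wronskian f v).coeff d = ((a : K) - n) * (f.coeff n * v.coeff a) := by
  rw [← coeff_X_mul, hd, X_mul_wronskian, coeff_sub,
    coeff_mul_add_eq_of_natDegree_le hf (natDegree_X_mul_derivative_le hv),
    coeff_mul_add_eq_of_natDegree_le (natDegree_X_mul_derivative_le hf) hv,
    X_mul_derivative_coeff, X_mul_derivative_coeff]
  ring

theorem natDegree_wronskian_le {f v : K[X]} {n a d : ℕ} (hf : f.natDegree ≤ n)
    (hv : v.natDegree ≤ a) (hd : d + 1 = n + a) : (wronskian f v).natDegree ≤ d := by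
  rw [natDegree_le_iff_coeff_eq_zero]
  intro j hj
  rw [← coeff_X_mul, X_mul_wronskian]
  refine coeff_eq_zero_of_natDegree_lt (lt_of_le_of_lt (natDegree_sub_le_of_le
    (natDegree_mul_le_of_le hf (natDegree_X_mul_derivative_le hv))
    (natDegree_mul_le_of_le (natDegree_X_mul_derivative_le hf) hv)) ?_)
  rw [max_self]; omega

end Wronskian

section Residue

/-- Wronskians with `f` are numerators `p` for which `p / f²`, here the derivative of `v / f`, has
no residues. -/
theorem derivative_wronskian_identity {K : Type*} [CommRing K] (f v : K[X]) :
    derivative (derivative f) * wronskian f v - derivative f * derivative (wronskian f v) =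
      f * (derivative (derivative f) * derivative v -
        derivative f * derivative (derivative v)) := by
  simp only [wronskian, derivative_sub, derivative_mul]; ring

/-- Each `p` with `f ∣ f''p - f'p'`, that is, such that `p / f²` has no residue at a simple root of
`f`, is a Wronskian `f v' - f' v` up to a multiple of `f²`. -/
theorem exists_eq_wronskian_add {K : Type*} [CommRing K] [Nontrivial K] {f p : K[X]} (hf : f.Monic)
    (hsep : f.Separable) (h : f ∣ derivative (derivative f) * p - derivative f * derivative p) :
    ∃ v u : K[X], v.degree < f.degree ∧ p = wronskian f v + f ^ 2 * u := by
  obtain ⟨a, c, hac⟩ := hsep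
  set v := (-c * p) %ₘ f with hv
  have hvq : v = -c * p - f * ((-c * p) /ₘ f) := by
    rw [hv, modByMonic_eq_sub_mul_div]
  set q := (-c * p) /ₘ f
  obtain ⟨u₁, hu₁⟩ : ∃ u₁, p - wronskian f v = f * u₁ := by
    refine ⟨a * p - derivative f * q - derivative v, ?_⟩
    rw [wronskian]
    have : derivative f * v = -p + f * (a * p - derivative f * q) := by
      rw [hvq]; linear_combination (-p) * hac
    linear_combination this
  have hdvd : f ∣ u₁ * derivative f ^ 2 := by
    have h1 := derivative_wronskian_identity f v
    obtain ⟨w, hw⟩ := h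
    have h2 : p = wronskian f v + f * u₁ := by rw [← hu₁]; ring
    refine ⟨-w + (derivative (derivative f) * derivative v -
      derivative f * derivative (derivative v)) + derivative (derivative f) * u₁ -
      derivative f * derivative u₁, ?_⟩
    have h3 : derivative p = derivative (wronskian f v) +
        (derivative f * u₁ + f * derivative u₁) := by
      rw [← derivative_mul, ← derivative_add, ← h2]
    rw [h3] at hw
    linear_combination (-1 : K[X]) * hw + h1 + derivative (derivative f) * h2
  obtain ⟨u, hu⟩ := (IsCoprime.pow_right (n := 2) ⟨a, c, hac⟩ :
    IsCoprime f (derivative f ^ 2)).dvd_of_dvd_mul_right hdvd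
  refine ⟨v, u, degree_modByMonic_lt _ hf, ?_⟩
  rw [hu] at hu₁
  linear_combination hu₁

/-- The degrees of the polynomials `p` such that `p / f²` has no residues. -/
theorem natDegree_of_dvd {k : Type*} [Field k] [CharZero k] {f p : k[X]} (hf : f.Monic)
    (hsep : f.Separable) (hp : p ≠ 0)
    (h : f ∣ derivative (derivative f) * p - derivative f * derivative p) :
    f.natDegree ≤ p.natDegree + 1 ∧ p.natDegree + 1 ≠ 2 * f.natDegree := by
  obtain ⟨v, u, hv, hpw⟩ := exists_eq_wronskian_add hf hsep h
  have hwle : v ≠ 0 → ∃ d, d + 1 = f.natDegree + v.natDegree ∧ d + 1 < 2 * f.natDegree ∧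
      (wronskian f v).natDegree = d := fun hv0 => by
    have hlt : v.natDegree < f.natDegree :=
      (natDegree_lt_natDegree_iff hv0).mpr hv
    refine ⟨f.natDegree + v.natDegree - 1, by omega, by omega, ?_⟩
    refine natDegree_eq_of_le_of_coeff_ne_zero
      (natDegree_wronskian_le le_rfl le_rfl (by omega)) ?_
    rw [wronskian_coeff (n := f.natDegree) (a := v.natDegree) le_rfl le_rfl (by omega)]
    refine mul_ne_zero (sub_ne_zero.mpr (by exact_mod_cast hlt.ne)) (mul_ne_zero ?_ ?_)
    · rw [hf.coeff_natDegree]; exact one_ne_zero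
    · exact leadingCoeff_ne_zero.mpr hv0
  by_cases hu : u = 0
  · rw [hu, mul_zero, add_zero] at hpw
    have hv0 : v ≠ 0 := fun h0 => hp (by rw [hpw, h0]; simp)
    obtain ⟨d, hd, hd', hdeg⟩ := hwle hv0
    rw [hpw, hdeg]
    omega
  · have hfu : (f ^ 2 * u).natDegree = 2 * f.natDegree + u.natDegree := by
      rw [(hf.pow 2).natDegree_mul' hu, hf.natDegree_pow]
    have hpd : p.natDegree = 2 * f.natDegree + u.natDegree := by
      by_cases hv0 : v = 0
      · rw [hpw, hv0, ← hfu]; simp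
      · obtain ⟨d, hd, hd', hdeg⟩ := hwle hv0
        rw [hpw, natDegree_add_eq_right_of_natDegree_lt (by omega), hfu]
    omega

end Residue

/-! ### Gegenbauer polynomials -/

section Gegenbauer

/-- The coefficients of `∏ⱼ (z - zⱼ)`, which are also the Fourier coefficients of the Gegenbauer
polynomial; the form with rising factorials makes the symmetry `i ↦ n - i` visible. -/
noncomputable def gegenbauerCoeff (m n i : ℕ) : ℂ :=
  n.choose i * m.ascFactorial i * m.ascFactorial (n - i) / m.ascFactorial n

theorem ascFactorial_cast_ne_zero {m : ℕ} (hm : 1 ≤ m) (n : ℕ) : (m.ascFactorial n : ℂ) ≠ 0 := by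
  obtain ⟨m, rfl⟩ := Nat.exists_eq_add_of_le' hm
  exact_mod_cast (Nat.ascFactorial_pos m n).ne'

theorem gegenbauerCoeff_eq {m n i : ℕ} (hm : 1 ≤ m) (hi : i ≤ n) :
    gegenbauerCoeff m n i =
      (n.choose i : ℂ) * ((m + i - 1).choose i : ℂ) / ((m + n - 1).choose i : ℂ) := by
  obtain ⟨m, rfl⟩ := Nat.exists_eq_add_of_le' hm
  obtain ⟨l, rfl⟩ := Nat.exists_eq_add_of_le' hi
  have h1 : ((m + 1).ascFactorial i : ℂ) = (i.factorial : ℂ) * ((m + 1 + i - 1).choose i : ℂ) := by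
    rw [Nat.ascFactorial_eq_factorial_mul_choose, show m + 1 + i - 1 = m + i by omega]
    push_cast; ring
  have h2 : ((m + 1).ascFactorial (l + i) : ℂ) = ((m + 1).ascFactorial l : ℂ) *
      ((i.factorial : ℂ) * ((m + 1 + (l + i) - 1).choose i : ℂ)) := by
    rw [← Nat.ascFactorial_mul_ascFactorial, show m + 1 + l = (m + l) + 1 by ring,
      Nat.ascFactorial_eq_factorial_mul_choose (m + l),
      show m + 1 + (l + i) - 1 = m + l + i by omega]
    push_cast; rfl
  have h3 := ascFactorial_cast_ne_zero hm l
  have h4 : (i.factorial : ℂ) ≠ 0 := by exact_mod_cast i.factorial_ne_zero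
  have h5 : ((m + 1 + (l + i) - 1).choose i : ℂ) ≠ 0 := by
    exact_mod_cast (Nat.choose_pos (by omega)).ne'
  rw [gegenbauerCoeff, h1, h2, Nat.add_sub_cancel]
  field_simp

theorem gegenbauerCoeff_symm {m n i : ℕ} (hi : i ≤ n) :
    gegenbauerCoeff m n (n - i) = gegenbauerCoeff m n i := by
  rw [gegenbauerCoeff, gegenbauerCoeff, Nat.choose_symm hi, Nat.sub_sub_self hi]
  ring

theorem gegenbauerCoeff_zero {m n : ℕ} (hm : 1 ≤ m) : gegenbauerCoeff m n 0 = 1 := by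
  have := ascFactorial_cast_ne_zero hm n
  simp [gegenbauerCoeff, this]

/-- The ratio of consecutive coefficients, which makes the sum in the Gegenbauer equation
telescope. -/
theorem gegenbauerCoeff_succ {m n i : ℕ} (hm : 1 ≤ m) (hi : i ≤ n) :
    gegenbauerCoeff m n (i + 1) * ((i + 1) * (n + m - i - 1)) =
      gegenbauerCoeff m n i * ((n - i) * (m + i)) := by
  obtain ⟨l, rfl⟩ := Nat.exists_eq_add_of_le' hi
  have h0 := ascFactorial_cast_ne_zero hm (l + i)
  cases l with
  | zero => simp [gegenbauerCoeff]
  | succ l =>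
    have h1 : ((l + 1 + i).choose (i + 1) : ℂ) * (i + 1) = (l + 1 + i).choose i * (l + 1) := by
      have := Nat.choose_succ_right_eq (l + 1 + i) i
      rw [show l + 1 + i - i = l + 1 by omega] at this
      exact_mod_cast this
    have h2 : (m.ascFactorial (i + 1) : ℂ) = (m + i) * m.ascFactorial i := by
      rw [Nat.ascFactorial_succ]; push_cast; ring
    have h3 : (m.ascFactorial (l + 1) : ℂ) = (m + l) * m.ascFactorial l := by
      rw [Nat.ascFactorial_succ]; push_cast; ring
    rw [gegenbauerCoeff, gegenbauerCoeff, show l + 1 + i - (i + 1) = l by omega,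
      show l + 1 + i - i = l + 1 by omega, h2, h3]
    field_simp
    push_cast
    linear_combination ((m : ℂ) + i) * m.ascFactorial i * m.ascFactorial l * ((m : ℂ) + l) * h1

/-- The monic Gegenbauer polynomial with parameter `m` of degree `n`, as a Fourier cosine sum
`2⁻ⁿ ∑ᵢ aᵢ T_{n-2i}` of Chebyshev polynomials. -/
noncomputable def gegenbauer (m n : ℕ) : ℂ[X] :=
  ∑ i ∈ Finset.range (n + 1),
    C ((2 ^ n)⁻¹ * gegenbauerCoeff m n i) * Chebyshev.T ℂ ((n : ℤ) - 2 * i)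

/-- The Gegenbauer equation. In terms of the polynomials `U_k` the sum telescopes by the recursion
of the coefficients. -/
theorem gegenbauer_ode {m : ℕ} (n : ℕ) (hm : 1 ≤ m) :
    (1 - X ^ 2) * derivative (derivative (gegenbauer m n)) -
      (2 * (m : ℂ[X]) + 1) * X * derivative (gegenbauer m n) +
      ((n : ℂ[X]) * ((n : ℂ[X]) + 2 * (m : ℂ[X]))) * gegenbauer m n = 0 := by
  let V : ℕ → ℂ[X] := fun i =>
    C (4 * i * (n - i + m) * ((2 ^ n)⁻¹ * gegenbauerCoeff m n i)) *
      Chebyshev.U ℂ ((n : ℤ) - 2 * i)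
  have hterm : ∀ i ∈ Finset.range (n + 1),
      (2 : ℂ[X]) * (C ((2 ^ n)⁻¹ * gegenbauerCoeff m n i) *
        ((1 - X ^ 2) * derivative (derivative (Chebyshev.T ℂ ((n : ℤ) - 2 * i))) -
        (2 * (m : ℂ[X]) + 1) * X * derivative (Chebyshev.T ℂ ((n : ℤ) - 2 * i)) +
        ((n : ℂ[X]) * ((n : ℂ[X]) + 2 * (m : ℂ[X]))) * Chebyshev.T ℂ ((n : ℤ) - 2 * i))) =
      V i - V (i + 1) := by
    intro i hi
    have hi' : i ≤ n := Nat.lt_succ_iff.mp (Finset.mem_range.mp hi)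
    have h1 := Chebyshev.one_sub_X_sq_mul_derivative_derivative_T_eq_poly_in_T (R := ℂ)
      ((n : ℤ) - 2 * i)
    rw [Function.iterate_succ_apply, Function.iterate_one, Chebyshev.T_derivative_eq_U] at h1
    have h2 := Chebyshev.two_mul_T_eq_U_sub_U ℂ ((n : ℤ) - 2 * i - 2)
    rw [sub_add_cancel] at h2
    have h3 := Chebyshev.U_add_two ℂ ((n : ℤ) - 2 * i - 2)
    rw [sub_add_cancel, show (n : ℤ) - 2 * i - 2 + 1 = n - 2 * i - 1 by ring] at h3
    have h4 : (gegenbauerCoeff m n (i + 1)) * ((i + 1) * (n + m - i - 1)) =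
      gegenbauerCoeff m n i * ((n - i) * (m + i)) := gegenbauerCoeff_succ hm hi'
    have h5 : V (i + 1) = C (4 * ((2 ^ n)⁻¹ * gegenbauerCoeff m n i) * ((n - i) * (m + i))) *
        Chebyshev.U ℂ ((n : ℤ) - 2 * i - 2) := by
      simp only [V]
      congr 2
      · push_cast
        linear_combination (4 * (2 ^ n)⁻¹ : ℂ) * h4
      · push_cast; ring
    rw [h5, Chebyshev.T_derivative_eq_U, h1]
    simp only [V, C_mul, C_sub, C_add, map_natCast, map_ofNat, Int.cast_sub, Int.cast_mul,
      Int.cast_natCast, Int.cast_ofNat]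
    set g := C (gegenbauerCoeff m n i)
    set c := (C ((2 : ℂ) ^ n)⁻¹)
    linear_combination (c * g * (n * (n + 2 * m) - (n - 2 * i) ^ 2)) * h2 +
      (2 * m * (n - 2 * i) * c * g) * h3
  have hsum : (2 : ℂ[X]) * ((1 - X ^ 2) * derivative (derivative (gegenbauer m n)) -
      (2 * (m : ℂ[X]) + 1) * X * derivative (gegenbauer m n) +
      ((n : ℂ[X]) * ((n : ℂ[X]) + 2 * (m : ℂ[X]))) * gegenbauer m n) = 0 := by
    have : (2 : ℂ[X]) * ((1 - X ^ 2) * derivative (derivative (gegenbauer m n)) -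
      (2 * (m : ℂ[X]) + 1) * X * derivative (gegenbauer m n) +
      ((n : ℂ[X]) * ((n : ℂ[X]) + 2 * (m : ℂ[X]))) * gegenbauer m n) =
        ∑ i ∈ Finset.range (n + 1), (V i - V (i + 1)) := by
      rw [← Finset.sum_congr rfl hterm]
      simp only [gegenbauer, derivative_sum, derivative_C_mul, Finset.mul_sum,
        ← Finset.sum_sub_distrib, ← Finset.sum_add_distrib]
      exact Finset.sum_congr rfl fun i _ => by ring
    rw [this, Finset.sum_range_sub']
    simp [V, gegenbauerCoeff]
  exact (mul_eq_zero.mp hsum).resolve_left two_ne_zero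

theorem natDegree_gegenbauer_le (m n : ℕ) : (gegenbauer m n).natDegree ≤ n := by
  refine natDegree_sum_le_of_forall_le _ _ fun i hi => ?_
  refine (natDegree_C_mul_le _ _).trans ?_
  have := Finset.mem_range.mp hi
  rw [Chebyshev.natDegree_T]
  omega

theorem gegenbauer_coeff_self {m n : ℕ} (hm : 1 ≤ m) (hn : 1 ≤ n) :
    (gegenbauer m n).coeff n = 1 := by
  have hsmall : ∀ i, 1 ≤ i → i < n → (Chebyshev.T ℂ ((n : ℤ) - 2 * i)).coeff n = 0 :=
    fun i h1 h2 => coeff_eq_zero_of_natDegree_lt (by rw [Chebyshev.natDegree_T]; omega)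
  have htop : (Chebyshev.T ℂ (n : ℤ)).coeff n = 2 ^ (n - 1) := by
    have := Chebyshev.leadingCoeff_T ℂ (n : ℤ)
    rw [leadingCoeff, Chebyshev.natDegree_T, Int.natAbs_natCast] at this
    simpa using this
  have hn' : gegenbauerCoeff m n n = 1 := by
    have := gegenbauerCoeff_symm (m := m) (Nat.zero_le n)
    rwa [Nat.sub_zero, gegenbauerCoeff_zero hm] at this
  rw [gegenbauer, finsetSum_coeff]
  simp only [coeff_C_mul]
  obtain ⟨n, rfl⟩ := Nat.exists_eq_add_of_le' hn
  rw [Finset.sum_range_succ, Finset.sum_range_succ', Finset.sum_eq_zero]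
  · rw [hn', gegenbauerCoeff_zero hm]
    rw [show ((n + 1 : ℕ) : ℤ) - 2 * ((n + 1 : ℕ) : ℤ) = -((n + 1 : ℕ) : ℤ) by ring,
      Chebyshev.T_neg, show ((n + 1 : ℕ) : ℤ) - 2 * ((0 : ℕ) : ℤ) = ((n + 1 : ℕ) : ℤ) by simp,
      htop]
    rw [Nat.add_sub_cancel]
    field_simp
    ring
  · intro i hi
    rw [hsmall (i + 1) (by omega) (by have := Finset.mem_range.mp hi; omega), mul_zero]

/-- The Gegenbauer polynomial has the parity of its degree. -/
theorem gegenbauer_coeff_eq_zero {m n i : ℕ} (h : ¬ Even (n + i)) :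
    (gegenbauer m n).coeff i = 0 := by
  have h1 : (gegenbauer m n).comp (C (-1) * X) = (-1) ^ n * gegenbauer m n := by
    refine Polynomial.funext fun x => ?_
    simp only [gegenbauer, eval_comp, eval_neg, eval_X, neg_mul, one_mul, map_neg,
      map_one, eval_finsetSum, eval_mul, eval_C, Chebyshev.T_eval_neg, eval_pow, eval_one,
      Finset.mul_sum]
    refine Finset.sum_congr rfl fun j _ => ?_
    have : ((((n : ℤ) - 2 * j).negOnePow : ℤˣ) : ℤ) = (-1) ^ n := by
      rw [Int.negOnePow_sub, Int.negOnePow_even (2 * (j : ℤ)) (even_two_mul _), mul_one]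
      simp [Int.negOnePow_def]
    rw [show ((((n : ℤ) - 2 * j).negOnePow : ℤˣ) : ℂ) = (-1) ^ n by
      exact_mod_cast congrArg (Int.cast (R := ℂ)) this]
    ring
  have h2 := congrArg (fun p => coeff p i) h1
  simp only [comp_C_mul_X_coeff] at h2
  rw [show ((-1 : ℂ[X]) ^ n) = C ((-1) ^ n) by simp, coeff_C_mul] at h2
  rw [Nat.not_even_iff_odd, Nat.odd_add] at h
  rcases Nat.even_or_odd n with hn | hn
  · have hi : Odd i := by
      by_contra hi
      exact (Nat.not_odd_iff_even.mpr hn) (h.mpr (Nat.not_odd_iff_even.mp hi))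
    rw [hn.neg_one_pow, hi.neg_one_pow] at h2
    linear_combination (-1 / 2 : ℂ) * h2
  · rw [hn.neg_one_pow, (h.mp hn).neg_one_pow] at h2
    linear_combination (1 / 2 : ℂ) * h2

/-- `C(cos θ)` is, up to the factor `e^{inθ}`, the polynomial `∑ aᵢ zⁱ` at `z = e^{2iθ}`. -/
theorem gegenbauer_eval_cos (m n : ℕ) (θ : ℂ) :
    2 ^ n * Complex.exp (n * (Complex.I * θ)) * (gegenbauer m n).eval (Complex.cos θ) =
      ∑ i ∈ Finset.range (n + 1),
        gegenbauerCoeff m n i * Complex.exp (2 * Complex.I * θ) ^ (n - i) := by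
  have hsymm : ∑ i ∈ Finset.range (n + 1),
        gegenbauerCoeff m n i * Complex.exp (2 * Complex.I * θ) ^ (n - i) =
      ∑ i ∈ Finset.range (n + 1),
        gegenbauerCoeff m n i * Complex.exp (2 * Complex.I * θ) ^ i := by
    rw [← Finset.sum_range_reflect]
    refine Finset.sum_congr rfl fun i hi => ?_
    have hi' : i ≤ n := Nat.lt_succ_iff.mp (Finset.mem_range.mp hi)
    rw [show n + 1 - 1 - i = n - i by omega, gegenbauerCoeff_symm hi', Nat.sub_sub_self hi']
  have key : 2 * (2 ^ n * Complex.exp (n * (Complex.I * θ)) *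
      (gegenbauer m n).eval (Complex.cos θ)) =
      2 * ∑ i ∈ Finset.range (n + 1),
        gegenbauerCoeff m n i * Complex.exp (2 * Complex.I * θ) ^ (n - i) := by
    nth_rewrite 2 [two_mul]
    nth_rewrite 2 [hsymm]
    rw [← Finset.sum_add_distrib, gegenbauer, eval_finsetSum, Finset.mul_sum, Finset.mul_sum]
    refine Finset.sum_congr rfl fun i hi => ?_
    have hi' : i ≤ n := Nat.lt_succ_iff.mp (Finset.mem_range.mp hi)
    rw [eval_mul, eval_C, Chebyshev.T_complex_cos, Complex.cos]
    have h1 : Complex.exp (2 * Complex.I * θ) ^ (n - i) = Complex.exp (n * (Complex.I * θ)) *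
        Complex.exp (((n : ℤ) - 2 * i : ℤ) * θ * Complex.I) := by
      rw [← Complex.exp_nat_mul, ← Complex.exp_add]
      congr 1
      push_cast [Nat.cast_sub hi']; ring
    have h2 : Complex.exp (2 * Complex.I * θ) ^ i = Complex.exp (n * (Complex.I * θ)) *
        Complex.exp (-(((n : ℤ) - 2 * i : ℤ) * θ) * Complex.I) := by
      rw [← Complex.exp_nat_mul, ← Complex.exp_add]
      congr 1
      push_cast; ring
    rw [h1, h2]
    have : (2 : ℂ) ^ n ≠ 0 := pow_ne_zero _ two_ne_zero
    field_simp
  exact mul_left_cancel₀ two_ne_zero key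

end Gegenbauer

/-! ### The vectors of the configuration as zeros of the Gegenbauer polynomial -/

section Roots

theorem prod_sub_eq_sum_gegenbauerCoeff {m n : ℕ} (hm : 1 ≤ m) (z : Fin n → ℂ)
    (hz : ∀ i : ℕ, 1 ≤ i → i ≤ n → MvPolynomial.eval z (MvPolynomial.esymm (Fin n) ℂ i) =
      (-1) ^ i * (n.choose i : ℂ) * ((m + i - 1).choose i : ℂ) / ((m + n - 1).choose i : ℂ))
    (w : ℂ) :
    ∏ j, (w - z j) = ∑ i ∈ Finset.range (n + 1), gegenbauerCoeff m n i * w ^ (n - i) := by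
  have h := congrArg (eval w) (Multiset.prod_X_sub_X_eq_sum_esymm (Finset.univ.val.map z))
  rw [Multiset.map_map, eval_multiset_prod, Multiset.map_map, eval_finsetSum] at h
  simp only [Function.comp_def, eval_sub, eval_X, eval_C, Multiset.card_map, Finset.card_val,
    Finset.card_univ, Fintype.card_fin, eval_mul, eval_pow, eval_neg, eval_one] at h
  rw [show ∏ j, (w - z j) = (Multiset.map (fun x => w - z x) Finset.univ.val).prod from rfl, h]
  refine Finset.sum_congr rfl fun i hi => ?_
  have hi' : i ≤ n := Nat.lt_succ_iff.mp (Finset.mem_range.mp hi)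
  rw [← mul_assoc]
  congr 1
  rw [gegenbauerCoeff_eq hm hi', ← MvPolynomial.aeval_esymm_eq_multiset_esymm (Fin n) ℂ]
  rcases Nat.eq_zero_or_pos i with rfl | hpos
  · simp
  · rw [MvPolynomial.aeval_eq_eval, hz i hpos hi']
    have : ((-1 : ℂ) ^ i) * (-1) ^ i = 1 := by rw [← mul_pow]; simp
    linear_combination ((n.choose i : ℂ) * ((m + i - 1).choose i : ℂ) / ((m + n - 1).choose i : ℂ))
      * this

/-- Up to sign, the unit vectors `(c, σ)` with `C(c) = 0` are the vectors `(cos φⱼ, sin φⱼ)`. -/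
theorem eval_gegenbauer_eq_zero_iff {m n : ℕ} (hm : 1 ≤ m) (φ : Fin n → ℂ)
    (hφ : ∀ i : ℕ, 1 ≤ i → i ≤ n →
      MvPolynomial.eval (fun j => Complex.exp (2 * Complex.I * φ j))
          (MvPolynomial.esymm (Fin n) ℂ i) =
        (-1) ^ i * (n.choose i : ℂ) * ((m + i - 1).choose i : ℂ) / ((m + n - 1).choose i : ℂ))
    {c σ : ℂ} (h : c ^ 2 + σ ^ 2 = 1) :
    (gegenbauer m n).eval c = 0 ↔ ∃ j, ∃ ε : ℂ, ε ^ 2 = 1 ∧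
      c = ε * Complex.cos (φ j) ∧ σ = ε * Complex.sin (φ j) := by
  obtain ⟨θ, hc, hs⟩ : ∃ θ, Complex.cos θ = c ∧ Complex.sin θ = σ := by
    obtain ⟨θ, hθ⟩ := Complex.cos_surjective c
    have h1 : (Complex.sin θ - σ) * (Complex.sin θ + σ) = 0 := by
      have := Complex.sin_sq_add_cos_sq θ
      rw [hθ] at this
      linear_combination this - h
    rcases mul_eq_zero.mp h1 with h2 | h2
    · exact ⟨θ, hθ, sub_eq_zero.mp h2⟩
    · exact ⟨-θ, by rw [Complex.cos_neg, hθ], by rw [Complex.sin_neg]; linear_combination -h2⟩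
  have h1 := gegenbauer_eval_cos m n θ
  rw [← prod_sub_eq_sum_gegenbauerCoeff hm _ hφ, hc] at h1
  have h2 : (2 : ℂ) ^ n * Complex.exp (n * (Complex.I * θ)) ≠ 0 :=
    mul_ne_zero (pow_ne_zero _ two_ne_zero) (Complex.exp_ne_zero _)
  have h3 : (gegenbauer m n).eval c = 0 ↔
      ∏ j, (Complex.exp (2 * Complex.I * θ) - Complex.exp (2 * Complex.I * φ j)) = 0 := by
    rw [← h1, mul_eq_zero, or_iff_right h2]
  rw [h3, Finset.prod_eq_zero_iff]
  have hexp : ∀ x : ℂ, Complex.exp (2 * Complex.I * x) =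
      (Complex.cos x + Complex.sin x * Complex.I) ^ 2 := fun x => by
    rw [← Complex.exp_mul_I, ← Complex.exp_nat_mul]; congr 1; push_cast; ring
  constructor
  · rintro ⟨j, -, hj⟩
    refine ⟨j, Complex.exp ((θ - φ j) * Complex.I), ?_, ?_, ?_⟩
    · rw [← Complex.exp_nat_mul, show ((2 : ℕ) : ℂ) * ((θ - φ j) * Complex.I) =
        2 * Complex.I * θ - 2 * Complex.I * φ j by push_cast; ring, Complex.exp_sub,
        sub_eq_zero.mp hj, div_self (Complex.exp_ne_zero _)]
    all_goals
      have hj' : Complex.exp (2 * Complex.I * θ) = Complex.exp (2 * Complex.I * φ j) :=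
        sub_eq_zero.mp hj
      have e1 : Complex.exp ((θ - φ j) * Complex.I) * Complex.exp (φ j * Complex.I) =
          Complex.exp (θ * Complex.I) := by rw [← Complex.exp_add]; congr 1; ring
      have e2 : Complex.exp ((θ - φ j) * Complex.I) * Complex.exp (-φ j * Complex.I) =
          Complex.exp (-θ * Complex.I) := by
        have : Complex.exp ((θ - φ j) * Complex.I) * Complex.exp (-φ j * Complex.I) =
            Complex.exp (-θ * Complex.I) *
              (Complex.exp (2 * Complex.I * θ) / Complex.exp (2 * Complex.I * φ j)) := by
          rw [← Complex.exp_sub, ← Complex.exp_add, ← Complex.exp_add]; congr 1; ring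
        rw [this, hj', div_self (Complex.exp_ne_zero _), mul_one]
    · rw [← hc, Complex.cos, Complex.cos, ← e1, ← e2]; ring
    · rw [← hs, Complex.sin, Complex.sin, ← e1, ← e2]; ring
  · rintro ⟨j, ε, hε, hcj, hsj⟩
    refine ⟨j, Finset.mem_univ j, ?_⟩
    rw [hexp, hexp, hc, hs, hcj, hsj]
    linear_combination (Complex.cos (φ j) + Complex.sin (φ j) * Complex.I) ^ 2 * hε

end Roots

/-! ### Zeros of solutions of the Gegenbauer equation -/

section ODE

variable {k : Type*} [Field k] [CharZero k]

/-- The Gegenbauer equation differentiated `j` times. -/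
theorem iterate_derivative_ode {f : k[X]} {r : k} {a N : ℕ}
    (h : (C r - X ^ 2) * derivative (derivative f) - ((a : k[X]) + 1) * X * derivative f +
      (N : k[X]) * f = 0) (j : ℕ) :
    (C r - X ^ 2) * derivative^[j + 2] f -
      ((a : k[X]) + 1 + 2 * (j : k[X])) * X * derivative^[j + 1] f +
      ((N : k[X]) - (j : k[X]) * ((j : k[X]) + (a : k[X]))) * derivative^[j] f = 0 := by
  induction j with
  | zero => simpa using h
  | succ j ih =>
    have h1 := congrArg derivative ih
    simp only [derivative_add, derivative_sub, derivative_mul, derivative_C, derivative_X,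
      derivative_X_pow, derivative_natCast, derivative_one, derivative_zero, derivative_ofNat,
      ← Function.iterate_succ_apply' derivative] at h1
    rw [show j + 1 + 2 = j + 2 + 1 by ring, show j + 1 + 1 = j + 2 by ring]
    push_cast
    push_cast at h1
    simp only [Nat.succ_eq_add_one, C_ofNat] at h1
    rw [show j + 1 + 1 = j + 2 by ring] at h1
    linear_combination h1

/-- A nonzero solution of the Gegenbauer equation has neither multiple zeros nor zeros at the
singular points `x² = r`: all its derivatives would vanish there. -/
theorem ode_root {f : k[X]} {r : k} {a N : ℕ} (hf : f ≠ 0) (hr : r ≠ 0)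
    (h : (C r - X ^ 2) * derivative (derivative f) - ((a : k[X]) + 1) * X * derivative f +
      (N : k[X]) * f = 0) {x : k} (hx : f.eval x = 0) :
    (derivative f).eval x ≠ 0 ∧ r - x ^ 2 ≠ 0 := by
  have hode : ∀ j : ℕ, (r - x ^ 2) * (derivative^[j + 2] f).eval x -
      ((a : k) + 1 + 2 * j) * x * (derivative^[j + 1] f).eval x +
      ((N : k) - j * (j + a)) * (derivative^[j] f).eval x = 0 := fun j => by
    have := congrArg (eval x) (iterate_derivative_ode h j)
    simpa using this
  have hall : ¬ ∀ j, (derivative^[j] f).eval x = 0 := fun hall =>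
    lt_irrefl _ ((lt_rootMultiplicity_iff_isRoot_iterate_derivative (t := x)
      (n := f.rootMultiplicity x) hf).mpr fun j _ => hall j)
  have hsing : r - x ^ 2 ≠ 0 := by
    intro h0
    have hx0 : x ≠ 0 := by
      rintro rfl
      exact hr (by simpa using h0)
    refine hall fun j => ?_
    induction j with
    | zero => simpa using hx
    | succ j ih =>
      have h1 := hode j
      rw [h0, ih, zero_mul, mul_zero, zero_sub, add_zero, neg_eq_zero] at h1
      have h2 : (a : k) + 1 + 2 * j ≠ 0 := by
        have : a + 1 + 2 * j ≠ 0 := by omega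
        exact_mod_cast this
      exact (mul_eq_zero.mp h1).resolve_left (mul_ne_zero h2 hx0)
  refine ⟨fun hx' => hall fun j => ?_, hsing⟩
  induction j using Nat.twoStepInduction with
  | zero => simpa using hx
  | one => simpa using hx'
  | more j ih1 ih2 =>
    have h1 := hode j
    rw [ih1, ih2, mul_zero, mul_zero, sub_zero, add_zero] at h1
    exact (mul_eq_zero.mp h1).resolve_left hsing

end ODE

/-! ### Weighted homogeneous polynomials in `ℂ[ρ][X]` -/

section Homogenization

/-- The homogenization of `f` of degree `n` when `f` only has terms of the parity of `n`: in
`ℂ[ρ][X]`, where `ρ` has weight two, `Xⁱ` becomes `ρ^((n-i)/2) Xⁱ`. -/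
noncomputable def evenHomogenization (n : ℕ) (f : ℂ[X]) : ℂ[X][X] :=
  ∑ i ∈ Finset.range (n + 1), monomial i (monomial ((n - i) / 2) (f.coeff i))

theorem evenHomogenization_coeff {n : ℕ} {f : ℂ[X]} (hf : f.natDegree ≤ n) (i : ℕ) :
    (evenHomogenization n f).coeff i = monomial ((n - i) / 2) (f.coeff i) := by
  rw [evenHomogenization, finsetSum_coeff]
  simp only [coeff_monomial]
  rw [Finset.sum_ite_eq']
  split_ifs with h
  · rfl
  · rw [coeff_eq_zero_of_natDegree_lt, monomial_zero_right]
    rw [Finset.mem_range] at h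
    omega

/-- `g ∈ ℂ[ρ][X]` is homogeneous of weight `d`, where `ρ` has weight two and `X` weight one. -/
def HasWeight (g : ℂ[X][X]) (d : ℕ) : Prop :=
  ∀ i j, (g.coeff i).coeff j ≠ 0 → i + 2 * j = d

theorem HasWeight.sub {g h : ℂ[X][X]} {d : ℕ} (hg : HasWeight g d) (hh : HasWeight h d) :
    HasWeight (g - h) d := fun i j hij => by
  by_contra hne
  refine hij ?_
  rw [coeff_sub, coeff_sub, not_not.mp (mt (hg i j) hne), not_not.mp (mt (hh i j) hne), sub_zero]

theorem HasWeight.mul {g h : ℂ[X][X]} {d e : ℕ} (hg : HasWeight g d) (hh : HasWeight h e) :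
    HasWeight (g * h) (d + e) := fun i j hij => by
  rw [coeff_mul, finsetSum_coeff] at hij
  obtain ⟨⟨a, b⟩, hab, h1⟩ := Finset.exists_ne_zero_of_sum_ne_zero hij
  rw [coeff_mul] at h1
  obtain ⟨⟨a', b'⟩, hab', h2⟩ := Finset.exists_ne_zero_of_sum_ne_zero h1
  rw [Finset.HasAntidiagonal.mem_antidiagonal] at hab hab'
  have h3 := hg a a' (left_ne_zero_of_mul h2)
  have h4 := hh b b' (right_ne_zero_of_mul h2)
  simp only at hab hab'
  omega

theorem HasWeight.X_pow (a : ℕ) : HasWeight (X ^ a) a := fun i j hij => by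
  rw [coeff_X_pow] at hij
  split_ifs at hij with h
  · rw [coeff_one] at hij
    split_ifs at hij with h'
    · omega
    · exact absurd rfl hij
  · exact absurd (coeff_zero j) hij

theorem HasWeight.C_C (a : ℂ) : HasWeight (C (C a)) 0 := fun i j hij => by
  rw [coeff_C] at hij
  split_ifs at hij with h
  · rw [coeff_C] at hij
    split_ifs at hij with h'
    · omega
    · exact absurd rfl hij
  · exact absurd (coeff_zero j) hij

theorem HasWeight.X_mul_derivative {g : ℂ[X][X]} {d : ℕ} (hg : HasWeight g d) :
    HasWeight (X * derivative g) d := fun i j hij => by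
  rw [X_mul_derivative_coeff, ← C_eq_natCast, coeff_C_mul] at hij
  exact hg i j (right_ne_zero_of_mul hij)

theorem HasWeight.of_X_mul {g : ℂ[X][X]} {d : ℕ} (hg : HasWeight (X * g) (d + 1)) :
    HasWeight g d := fun i j hij => by
  have := hg (i + 1) j (by rwa [coeff_X_mul])
  omega

theorem HasWeight.wronskian {g h : ℂ[X][X]} {d a b : ℕ} (hg : HasWeight g a)
    (hh : HasWeight h b) (hd : d + 1 = a + b) : HasWeight (wronskian g h) d := by
  refine HasWeight.of_X_mul ?_
  rw [X_mul_wronskian, hd]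
  exact (hg.mul hh.X_mul_derivative).sub (hg.X_mul_derivative.mul hh)

/-- The antiderivative in `X` without constant term of a polynomial in `ℂ[ρ][X]`. -/
noncomputable def antiderivative (g : ℂ[X][X]) : ℂ[X][X] :=
  g.sum fun i c => monomial (i + 1) (C ((i : ℂ) + 1)⁻¹ * c)

theorem antiderivative_coeff_succ (g : ℂ[X][X]) (i : ℕ) :
    (antiderivative g).coeff (i + 1) = C ((i : ℂ) + 1)⁻¹ * g.coeff i := by
  rw [antiderivative, Polynomial.sum, finsetSum_coeff]
  simp only [coeff_monomial, add_left_inj]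
  rw [Finset.sum_ite_eq']
  split_ifs with h
  · rfl
  · rw [notMem_support_iff.mp h, mul_zero]

theorem antiderivative_coeff_zero (g : ℂ[X][X]) : (antiderivative g).coeff 0 = 0 := by
  rw [antiderivative, Polynomial.sum, finsetSum_coeff]
  exact Finset.sum_eq_zero fun i _ => by rw [coeff_monomial, if_neg (Nat.succ_ne_zero i)]

theorem derivative_antiderivative (g : ℂ[X][X]) : derivative (antiderivative g) = g := by
  ext1 i
  rw [coeff_derivative, antiderivative_coeff_succ]
  have : (C ((i : ℂ) + 1)⁻¹ : ℂ[X]) * ((i : ℂ[X]) + 1) = 1 := by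
    rw [← C_eq_natCast, ← C_1, ← C_add, ← C_mul, inv_mul_cancel₀ (Nat.cast_add_one_ne_zero i)]
  linear_combination (g.coeff i) * this

theorem HasWeight.antiderivative {g : ℂ[X][X]} {d : ℕ} (hg : HasWeight g d) :
    HasWeight (antiderivative g) (d + 1) := fun i j hij => by
  cases i with
  | zero => exact absurd (by rw [antiderivative_coeff_zero, coeff_zero]) hij
  | succ i =>
    rw [antiderivative_coeff_succ, coeff_C_mul] at hij
    have := hg i j (right_ne_zero_of_mul hij)
    omega

end Homogenization

/-! ### The homogeneous Gegenbauer polynomial -/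

section Gamma

/-- The homogeneous Gegenbauer polynomial in `ℂ[ρ][X]`. On the plane, with `ρ = x₁² + x₂²` and
`X = x₂`, its zero set consists of the `n` lines of multiplicity one. -/
noncomputable def gegenbauerForm (m n : ℕ) : ℂ[X][X] := evenHomogenization n (gegenbauer m n)

variable {m n : ℕ}

theorem gegenbauerForm_coeff (i : ℕ) : (gegenbauerForm m n).coeff i =
    monomial ((n - i) / 2) ((gegenbauer m n).coeff i) :=
  evenHomogenization_coeff (natDegree_gegenbauer_le m n) i

theorem gegenbauerForm_coeff_of_lt {i : ℕ} (h : n < i) : (gegenbauerForm m n).coeff i = 0 := by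
  rw [gegenbauerForm_coeff, coeff_eq_zero_of_natDegree_lt
    ((natDegree_gegenbauer_le m n).trans_lt h), monomial_zero_right]

theorem natDegree_gegenbauerForm_le : (gegenbauerForm m n).natDegree ≤ n :=
  natDegree_le_iff_coeff_eq_zero.mpr fun _ h => gegenbauerForm_coeff_of_lt h

theorem gegenbauerForm_coeff_self (hm : 1 ≤ m) (hn : 1 ≤ n) :
    (gegenbauerForm m n).coeff n = 1 := by
  rw [gegenbauerForm_coeff, gegenbauer_coeff_self hm hn, Nat.sub_self, Nat.zero_div,
    monomial_zero_one]

theorem gegenbauerForm_monic (hm : 1 ≤ m) (hn : 1 ≤ n) : (gegenbauerForm m n).Monic :=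
  monic_of_natDegree_le_of_coeff_eq_one n natDegree_gegenbauerForm_le
    (gegenbauerForm_coeff_self hm hn)

theorem natDegree_gegenbauerForm (hm : 1 ≤ m) (hn : 1 ≤ n) : (gegenbauerForm m n).natDegree = n :=
  natDegree_eq_of_le_of_coeff_ne_zero natDegree_gegenbauerForm_le
    (by rw [gegenbauerForm_coeff_self hm hn]; exact one_ne_zero)

theorem gegenbauerForm_hasWeight : HasWeight (gegenbauerForm m n) n := fun i j hij => by
  have hi : i ≤ n := by
    by_contra h
    rw [gegenbauerForm_coeff_of_lt (not_le.mp h), coeff_zero] at hij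
    exact hij rfl
  rw [gegenbauerForm_coeff, coeff_monomial] at hij
  split_ifs at hij with h
  · have : Even (n + i) := by
      by_contra h'
      exact hij (gegenbauer_coeff_eq_zero h')
    rw [Nat.even_iff] at this
    omega
  · exact absurd rfl hij

theorem gegenbauerForm_evalEval (t x : ℂ) :
    (gegenbauerForm m n).evalEval (t ^ 2) (t * x) = t ^ n * (gegenbauer m n).eval x := by
  rw [evalEval, eval_eq_sum_range' (Nat.lt_succ_of_le natDegree_gegenbauerForm_le),
    eval_eq_sum_range' (Nat.lt_succ_of_le (natDegree_gegenbauer_le m n)), eval_finsetSum,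
    Finset.mul_sum]
  refine Finset.sum_congr rfl fun i hi => ?_
  have hi' : i ≤ n := Nat.lt_succ_iff.mp (Finset.mem_range.mp hi)
  rw [gegenbauerForm_coeff, eval_mul, eval_monomial, eval_pow, eval_C]
  by_cases h : Even (n + i)
  · rw [← pow_mul, mul_pow]
    have : 2 * ((n - i) / 2) + i = n := by rw [Nat.even_iff] at h; omega
    have h2 : t ^ n = t ^ (2 * ((n - i) / 2)) * t ^ i := by rw [← pow_add, this]
    rw [h2]; ring
  · rw [gegenbauer_coeff_eq_zero h]; ring

/-- The Gegenbauer equation in homogeneous form. -/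
theorem gegenbauerForm_ode (hm : 1 ≤ m) :
    (C X - X ^ 2) * derivative (derivative (gegenbauerForm m n)) -
      (((2 * m : ℕ) : ℂ[X][X]) + 1) * X * derivative (gegenbauerForm m n) +
      ((n * (n + 2 * m) : ℕ) : ℂ[X][X]) * gegenbauerForm m n = 0 := by
  -- In terms of the Euler operator `X d/dX` the equation is a two-term recursion of coefficients.
  have euler : ∀ {K : Type} [CommRing K] (f : K[X]) (r : K) (a N : ℕ) (i : ℕ),
      ((C r - X ^ 2) * derivative (derivative f) - ((a : K[X]) + 1) * X * derivative f +
        (N : K[X]) * f).coeff i =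
      r * (f.coeff (i + 2) * (i + 2) * (i + 1)) + (N - i * (i + a)) * f.coeff i := by
    intro K _ f r a N i
    have h1 : (C r - X ^ 2) * derivative (derivative f) - ((a : K[X]) + 1) * X * derivative f +
        (N : K[X]) * f = C r * derivative (derivative f) - X * derivative (X * derivative f) -
          C (a : K) * (X * derivative f) + C (N : K) * f := by
      rw [derivative_mul, derivative_X, C_eq_natCast, C_eq_natCast]; ring
    rw [h1]
    simp only [coeff_add, coeff_sub, coeff_C_mul, X_mul_derivative_coeff, coeff_derivative]
    push_cast
    rw [add_assoc i 1 1]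
    norm_num
    ring
  have hode := gegenbauer_ode n hm
  ext1 i
  rw [euler, coeff_zero]
  have h1 : (1 : ℂ) * ((gegenbauer m n).coeff (i + 2) * (i + 2) * (i + 1)) +
      ((n * (n + 2 * m) : ℕ) - i * (i + (2 * m : ℕ))) * (gegenbauer m n).coeff i = 0 := by
    rw [← euler, C_1, ← coeff_zero i, ← hode]
    push_cast; rfl
  rw [gegenbauerForm_coeff, gegenbauerForm_coeff]
  have h2 : (X : ℂ[X]) * monomial ((n - (i + 2)) / 2) ((gegenbauer m n).coeff (i + 2)) =
      monomial ((n - i) / 2) ((gegenbauer m n).coeff (i + 2)) := by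
    by_cases h : i + 2 ≤ n
    · rw [X_mul_monomial]; congr 2; omega
    · rw [coeff_eq_zero_of_natDegree_lt (lt_of_le_of_lt (natDegree_gegenbauer_le m n)
        (not_le.mp h)), monomial_zero_right, monomial_zero_right, mul_zero]
  have h3 := congrArg (monomial ((n - i) / 2)) h1
  rw [monomial_zero_right, map_add, one_mul] at h3
  rw [← h3, ← mul_assoc, ← mul_assoc, h2, ← C_mul_X_pow_eq_monomial, ← C_mul_X_pow_eq_monomial,
    ← C_mul_X_pow_eq_monomial, ← C_mul_X_pow_eq_monomial]
  simp only [C_mul, C_add, C_sub, map_natCast, map_ofNat, C_1]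
  push_cast
  ring

theorem gegenbauerForm_map_ode (hm : 1 ≤ m) (r : ℂ) :
    (C r - X ^ 2) * derivative (derivative ((gegenbauerForm m n).map (evalRingHom r))) -
      (((2 * m : ℕ) : ℂ[X]) + 1) * X * derivative ((gegenbauerForm m n).map (evalRingHom r)) +
      ((n * (n + 2 * m) : ℕ) : ℂ[X]) * (gegenbauerForm m n).map (evalRingHom r) = 0 := by
  have := congrArg (Polynomial.map (evalRingHom r)) (gegenbauerForm_ode (n := n) hm)
  simpa [derivative_map] using this

theorem gegenbauerForm_map_root (hm : 1 ≤ m) (hn : 1 ≤ n) {r x : ℂ} (hr : r ≠ 0)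
    (hx : ((gegenbauerForm m n).map (evalRingHom r)).eval x = 0) :
    (derivative ((gegenbauerForm m n).map (evalRingHom r))).eval x ≠ 0 ∧ r - x ^ 2 ≠ 0 :=
  ode_root ((gegenbauerForm_monic hm hn).map _).ne_zero hr (gegenbauerForm_map_ode hm r) hx

theorem gegenbauerForm_map_separable (hm : 1 ≤ m) (hn : 1 ≤ n) {r : ℂ} (hr : r ≠ 0) :
    ((gegenbauerForm m n).map (evalRingHom r)).Separable := by
  refine (isCoprime_iff_aeval_ne_zero_of_isAlgClosed (k := ℂ) ℂ _ _).mpr fun x => ?_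
  by_contra! h
  rw [coe_aeval_eq_eval] at h
  exact (gegenbauerForm_map_root hm hn hr h.1).1 h.2

/-- For `ρ = r ≠ 0` all roots are simple, hence divisibility can be tested at points. -/
theorem gegenbauerForm_dvd (hm : 1 ≤ m) (hn : 1 ≤ n) {f : ℂ[X][X]}
    (h : ∀ r x : ℂ, r ≠ 0 → (gegenbauerForm m n).evalEval r x = 0 → f.evalEval r x = 0) :
    gegenbauerForm m n ∣ f := by
  have hmon := gegenbauerForm_monic hm hn
  rw [← modByMonic_eq_zero_iff_dvd hmon]
  have hmap : ∀ r : ℂ, r ≠ 0 → (f %ₘ gegenbauerForm m n).map (evalRingHom r) = 0 := by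
    intro r hr
    rw [map_modByMonic _ hmon, modByMonic_eq_zero_iff_dvd (hmon.map _)]
    by_cases hf : f.map (evalRingHom r) = 0
    · rw [hf]; exact dvd_zero _
    rw [(IsAlgClosed.splits ((gegenbauerForm m n).map (evalRingHom r))).eq_prod_roots_of_monic
      (hmon.map _), Multiset.prod_X_sub_C_dvd_iff_le_roots hf,
      Multiset.le_iff_subset (nodup_roots (gegenbauerForm_map_separable hm hn hr))]
    intro x hx
    rw [mem_roots', IsRoot] at hx ⊢
    refine ⟨hf, ?_⟩
    rw [map_evalRingHom_eval] at hx ⊢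
    exact h r x hr hx.2
  ext1 i
  rw [coeff_zero]
  refine eq_zero_of_infinite_isRoot _ (Set.Infinite.mono (s := {0}ᶜ) (fun r hr => ?_)
    (Set.finite_singleton (0 : ℂ)).infinite_compl)
  have := congrArg (fun p => coeff p i) (hmap r hr)
  simpa using this

end Gamma

/-! ### The even and the odd parts of the quasi-invariants -/

section Components

/-- The even parts `g` of the quasi-invariants: those with `Γ ∣ g'`. -/
noncomputable def evenPart (m n : ℕ) : Submodule ℂ[X] ℂ[X][X] where
  carrier := {g | gegenbauerForm m n ∣ derivative g}
  add_mem' hp hq := by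
    rw [Set.mem_ofPred_eq, derivative_add]; exact dvd_add hp hq
  zero_mem' := by rw [Set.mem_ofPred_eq, derivative_zero]; exact dvd_zero _
  smul_mem' c p hp := by
    rw [Set.mem_ofPred_eq, derivative_smul, smul_eq_C_mul]; exact Dvd.dvd.mul_left hp _

/-- The odd parts `h` of the quasi-invariants, up to a power of `x₁`: those with
`Γ ∣ Γ'' h - Γ' h'`. -/
noncomputable def oddPart (m n : ℕ) : Submodule ℂ[X] ℂ[X][X] where
  carrier := {h | gegenbauerForm m n ∣ derivative (derivative (gegenbauerForm m n)) * h -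
    derivative (gegenbauerForm m n) * derivative h}
  add_mem' {p q} hp hq := by
    rw [Set.mem_ofPred_eq] at *
    convert dvd_add hp hq using 1
    rw [derivative_add]; ring
  zero_mem' := by simp
  smul_mem' c p hp := by
    rw [Set.mem_ofPred_eq] at *
    convert Dvd.dvd.mul_left hp (C c) using 1
    rw [smul_eq_C_mul, derivative_C_mul]; ring

variable {m n : ℕ}

theorem mem_evenPart {g : ℂ[X][X]} : g ∈ evenPart m n ↔ gegenbauerForm m n ∣ derivative g :=
  Iff.rfl

theorem mem_oddPart {h : ℂ[X][X]} : h ∈ oddPart m n ↔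
    gegenbauerForm m n ∣ derivative (derivative (gegenbauerForm m n)) * h -
      derivative (gegenbauerForm m n) * derivative h := Iff.rfl

theorem mul_mem_evenPart {g g' : ℂ[X][X]} (hg : g ∈ evenPart m n) (hg' : g' ∈ evenPart m n) :
    g * g' ∈ evenPart m n := by
  rw [mem_evenPart, derivative_mul]
  exact dvd_add (Dvd.dvd.mul_right hg _) (Dvd.dvd.mul_left hg' _)

theorem mul_mem_oddPart {g h : ℂ[X][X]} (hg : g ∈ evenPart m n) (hh : h ∈ oddPart m n) :
    g * h ∈ oddPart m n := by
  rw [mem_oddPart, derivative_mul]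
  convert dvd_sub (Dvd.dvd.mul_left hh g)
    (Dvd.dvd.mul_left hg (derivative (gegenbauerForm m n) * h)) using 1
  ring

theorem C_mem_evenPart (c : ℂ[X]) : C c ∈ evenPart m n := by
  rw [mem_evenPart, derivative_C]; exact dvd_zero _

theorem comp_mem_evenPart (s : ℂ[X][X]) {g : ℂ[X][X]} (hg : g ∈ evenPart m n) :
    s.comp g ∈ evenPart m n := by
  rw [mem_evenPart, derivative_comp]
  exact Dvd.dvd.mul_right hg _

/-- Above the constants, the degrees in `X` of elements of `evenPart` start at `n + 1`. -/
theorem natDegree_of_mem_evenPart (hm : 1 ≤ m) (hn : 1 ≤ n) {g : ℂ[X][X]} (hg : g ∈ evenPart m n) :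
    g.natDegree = 0 ∨ n + 1 ≤ g.natDegree := by
  by_contra! h
  have h1 : derivative g ≠ 0 := fun h0 => h.1 (derivative_eq_zero.mp h0)
  have h2 := natDegree_le_of_dvd hg h1
  rw [natDegree_gegenbauerForm hm hn] at h2
  have h3 := natDegree_derivative_lt h.1
  omega

theorem natDegree_of_mem_oddPart (hm : 1 ≤ m) (hn : 1 ≤ n) {h : ℂ[X][X]} (hh : h ∈ oddPart m n)
    (h0 : h ≠ 0) : n ≤ h.natDegree + 1 ∧ h.natDegree + 1 ≠ 2 * n := by
  -- Specialize `ρ` to a nonzero number at which the leading coefficient does not vanish.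
  obtain ⟨r, hr⟩ : ∃ r : ℂ, eval r (X * h.leadingCoeff) ≠ 0 := by
    by_contra! hall
    exact mul_ne_zero X_ne_zero (leadingCoeff_ne_zero.mpr h0)
      (Polynomial.funext fun r => by rw [hall r, eval_zero])
  rw [eval_mul, eval_X] at hr
  have hr0 : r ≠ 0 := left_ne_zero_of_mul hr
  have hdeg : (h.map (evalRingHom r)).natDegree = h.natDegree :=
    natDegree_map_of_leadingCoeff_ne_zero _ (right_ne_zero_of_mul hr)
  have hmon := gegenbauerForm_monic hm hn
  have h1 := Polynomial.map_dvd (evalRingHom r) hh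
  rw [Polynomial.map_sub, Polynomial.map_mul, Polynomial.map_mul, ← derivative_map,
    ← derivative_map, ← derivative_map] at h1
  have h2 := natDegree_of_dvd (hmon.map _) (gegenbauerForm_map_separable hm hn hr0)
    (fun h3 => right_ne_zero_of_mul hr (by
      have := congrArg (fun p => coeff p h.natDegree) h3
      simpa using this)) h1
  rwa [hdeg, hmon.natDegree_map, natDegree_gegenbauerForm hm hn] at h2

/-- The monic element `d ∫ Γ X^(d-n-1)` of `evenPart` of degree `d ≥ n + 1`. -/
noncomputable def evenElement (m n d : ℕ) : ℂ[X][X] :=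
  C (C (d : ℂ)) * antiderivative (gegenbauerForm m n * X ^ (d - (n + 1)))

theorem evenElement_mem (d : ℕ) : evenElement m n d ∈ evenPart m n := by
  rw [evenElement, mem_evenPart, derivative_C_mul, derivative_antiderivative]
  exact Dvd.dvd.mul_left (dvd_mul_right _ _) _

theorem evenElement_natDegree_le {d : ℕ} (hd : n + 1 ≤ d) : (evenElement m n d).natDegree ≤ d := by
  refine (natDegree_C_mul_le _ _).trans (natDegree_le_iff_coeff_eq_zero.mpr fun i hi => ?_)
  obtain ⟨i, rfl⟩ := Nat.exists_eq_add_of_le' (show 1 ≤ i by omega)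
  rw [antiderivative_coeff_succ, coeff_mul_X_pow', if_pos (by omega),
    gegenbauerForm_coeff_of_lt (by omega), mul_zero]

theorem evenElement_coeff (hm : 1 ≤ m) (hn : 1 ≤ n) {d : ℕ} (hd : n + 1 ≤ d) :
    (evenElement m n d).coeff d = 1 := by
  obtain ⟨e, rfl⟩ := Nat.exists_eq_add_of_le' (show 1 ≤ d by omega)
  rw [evenElement, coeff_C_mul, antiderivative_coeff_succ, coeff_mul_X_pow', if_pos (by omega),
    show e - (e + 1 - (n + 1)) = n by omega, gegenbauerForm_coeff_self hm hn, mul_one, ← C_mul,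
    Nat.cast_succ, mul_inv_cancel₀ (Nat.cast_add_one_ne_zero e), C_1]

theorem evenElement_monic (hm : 1 ≤ m) (hn : 1 ≤ n) {d : ℕ} (hd : n + 1 ≤ d) :
    (evenElement m n d).Monic :=
  monic_of_natDegree_le_of_coeff_eq_one d (evenElement_natDegree_le hd) (evenElement_coeff hm hn hd)

theorem natDegree_evenElement (hm : 1 ≤ m) (hn : 1 ≤ n) {d : ℕ} (hd : n + 1 ≤ d) :
    (evenElement m n d).natDegree = d :=
  natDegree_eq_of_le_of_coeff_ne_zero (evenElement_natDegree_le hd)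
    (by rw [evenElement_coeff hm hn hd]; exact one_ne_zero)

theorem evenElement_hasWeight {d : ℕ} (hd : n + 1 ≤ d) : HasWeight (evenElement m n d) d := by
  have := (HasWeight.C_C (d : ℂ)).mul
    (gegenbauerForm_hasWeight (m := m) (n := n).mul (HasWeight.X_pow (d - (n + 1)))).antiderivative
  rwa [show 0 + (n + (d - (n + 1)) + 1) = d by omega] at this

/-- The monic element of `oddPart` of degree `d`, where `d ≥ n - 1` and `d ≠ 2n - 1`, a multiple of
the Wronskian of `Γ` and `X^(d+1-n)`. -/
noncomputable def oddElement (m n d : ℕ) : ℂ[X][X] :=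
  C (C ((d : ℂ) + 1 - 2 * n)⁻¹) * wronskian (gegenbauerForm m n) (X ^ (d + 1 - n))

theorem oddElement_mem (d : ℕ) : oddElement m n d ∈ oddPart m n := by
  rw [oddElement, ← smul_eq_C_mul]
  refine Submodule.smul_mem _ _ ?_
  rw [mem_oddPart, derivative_wronskian_identity]
  exact dvd_mul_right _ _

theorem oddElement_natDegree_le {d : ℕ} (hd : n ≤ d + 1) : (oddElement m n d).natDegree ≤ d :=
  (natDegree_C_mul_le _ _).trans (natDegree_wronskian_le natDegree_gegenbauerForm_le
    (natDegree_X_pow_le _) (by omega))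

theorem oddElement_coeff (hm : 1 ≤ m) (hn : 1 ≤ n) {d : ℕ} (hd : n ≤ d + 1)
    (hd' : d + 1 ≠ 2 * n) : (oddElement m n d).coeff d = 1 := by
  rw [oddElement, coeff_C_mul, wronskian_coeff natDegree_gegenbauerForm_le
    (natDegree_X_pow_le (d + 1 - n)) (by omega), gegenbauerForm_coeff_self hm hn, coeff_X_pow_self,
    mul_one, mul_one, Nat.cast_sub hd]
  have : (d : ℂ) + 1 - 2 * n ≠ 0 := sub_ne_zero.mpr (by exact_mod_cast hd')
  have h2 : (((d + 1 : ℕ) : ℂ[X]) - n - n) = C ((d : ℂ) + 1 - 2 * n) := by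
    simp only [C_sub, C_add, C_mul, map_natCast, map_ofNat, C_1]
    push_cast; ring
  rw [h2, ← C_mul, inv_mul_cancel₀ this, C_1]

theorem oddElement_monic (hm : 1 ≤ m) (hn : 1 ≤ n) {d : ℕ} (hd : n ≤ d + 1)
    (hd' : d + 1 ≠ 2 * n) : (oddElement m n d).Monic :=
  monic_of_natDegree_le_of_coeff_eq_one d (oddElement_natDegree_le hd)
    (oddElement_coeff hm hn hd hd')

theorem natDegree_oddElement (hm : 1 ≤ m) (hn : 1 ≤ n) {d : ℕ} (hd : n ≤ d + 1)
    (hd' : d + 1 ≠ 2 * n) : (oddElement m n d).natDegree = d :=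
  natDegree_eq_of_le_of_coeff_ne_zero (oddElement_natDegree_le hd)
    (by rw [oddElement_coeff hm hn hd hd']; exact one_ne_zero)

theorem oddElement_hasWeight {d : ℕ} (hd : n ≤ d + 1) : HasWeight (oddElement m n d) d := by
  have := (HasWeight.C_C ((d : ℂ) + 1 - 2 * n)⁻¹).mul
    (gegenbauerForm_hasWeight (m := m) (n := n).wronskian (HasWeight.X_pow (d + 1 - n)) (d := d)
      (by omega))
  rwa [zero_add] at this

end Components

/-! ### Echelon bases of both parts over `ℂ[ρ, b]` -/

section EchelonBasis

variable {m n : ℕ}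

/-- The parameter `b`, of degree `n + 1`. -/
noncomputable def parameter (m n : ℕ) : ℂ[X][X] := evenElement m n (n + 1)

/-- The degrees of the basis of `evenPart`: `0, n + 2, …, 2n + 1`. -/
def evenDegree (n : ℕ) (i : Fin (n + 1)) : ℕ := if (i : ℕ) = 0 then 0 else n + 1 + i

/-- The degrees of the basis of `oddPart`, complementary to those of `evenPart`:
`3n, 2n - 2, …, n - 1`. -/
def oddDegree (n : ℕ) (i : Fin (n + 1)) : ℕ := 3 * n - evenDegree n i

/-- The basis of `evenPart`. -/
noncomputable def evenBasis (m n : ℕ) (i : Fin (n + 1)) : ℂ[X][X] :=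
  if (i : ℕ) = 0 then 1 else evenElement m n (n + 1 + i)

/-- The basis of `oddPart`. -/
noncomputable def oddBasis (m n : ℕ) (i : Fin (n + 1)) : ℂ[X][X] :=
  oddElement m n (oddDegree n i)

theorem parameter_mem : parameter m n ∈ evenPart m n := evenElement_mem _

theorem parameter_monic (hm : 1 ≤ m) (hn : 1 ≤ n) : (parameter m n).Monic :=
  evenElement_monic hm hn le_rfl

theorem natDegree_parameter (hm : 1 ≤ m) (hn : 1 ≤ n) : (parameter m n).natDegree = n + 1 :=
  natDegree_evenElement hm hn le_rfl

theorem evenBasis_mem (i : Fin (n + 1)) : evenBasis m n i ∈ evenPart m n := by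
  rw [evenBasis]
  split_ifs
  · rw [← C_1]; exact C_mem_evenPart 1
  · exact evenElement_mem _

theorem evenBasis_monic (hm : 1 ≤ m) (hn : 1 ≤ n) (i : Fin (n + 1)) : (evenBasis m n i).Monic := by
  rw [evenBasis]
  split_ifs
  · exact monic_one
  · exact evenElement_monic hm hn (by omega)

theorem natDegree_evenBasis (hm : 1 ≤ m) (hn : 1 ≤ n) (i : Fin (n + 1)) :
    (evenBasis m n i).natDegree = evenDegree n i := by
  rw [evenBasis, evenDegree]
  split_ifs
  · exact natDegree_one
  · exact natDegree_evenElement hm hn (by omega)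

theorem evenBasis_hasWeight (i : Fin (n + 1)) : HasWeight (evenBasis m n i) (evenDegree n i) := by
  rw [evenBasis, evenDegree]
  split_ifs
  · exact HasWeight.X_pow 0
  · exact evenElement_hasWeight (by omega)

theorem oddDegree_spec (hn : 1 ≤ n) (i : Fin (n + 1)) :
    n ≤ oddDegree n i + 1 ∧ oddDegree n i + 1 ≠ 2 * n := by
  have := i.isLt
  rw [oddDegree, evenDegree]
  split_ifs <;> omega

theorem evenDegree_add_oddDegree (i : Fin (n + 1)) : evenDegree n i + oddDegree n i = 3 * n := by
  have := i.isLt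
  rw [oddDegree, evenDegree]
  split_ifs <;> omega

theorem evenDegree_lt {i j : Fin (n + 1)} (h : i < j) : evenDegree n i < evenDegree n j := by
  have h' : (i : ℕ) < j := h
  rw [evenDegree, evenDegree]
  split_ifs <;> omega

theorem oddBasis_mem (i : Fin (n + 1)) : oddBasis m n i ∈ oddPart m n := oddElement_mem _

theorem oddBasis_monic (hm : 1 ≤ m) (hn : 1 ≤ n) (i : Fin (n + 1)) : (oddBasis m n i).Monic :=
  oddElement_monic hm hn (oddDegree_spec hn i).1 (oddDegree_spec hn i).2

theorem natDegree_oddBasis (hm : 1 ≤ m) (hn : 1 ≤ n) (i : Fin (n + 1)) :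
    (oddBasis m n i).natDegree = oddDegree n i :=
  natDegree_oddElement hm hn (oddDegree_spec hn i).1 (oddDegree_spec hn i).2

theorem oddBasis_hasWeight (hn : 1 ≤ n) (i : Fin (n + 1)) :
    HasWeight (oddBasis m n i) (oddDegree n i) :=
  oddElement_hasWeight (oddDegree_spec hn i).1

theorem eq_of_evenDegree_modEq (i j : Fin (n + 1))
    (h : evenDegree n i ≡ evenDegree n j [MOD (n + 1)]) : i = j := by
  have hmod : ∀ i : Fin (n + 1), evenDegree n i % (n + 1) = i := fun i => by
    rw [evenDegree]
    split_ifs with h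
    · rw [h, Nat.zero_mod]
    · rw [Nat.add_mod_left, Nat.mod_eq_of_lt i.isLt]
  rw [Nat.ModEq, hmod, hmod] at h
  exact Fin.ext h

theorem eq_of_oddDegree_modEq (i j : Fin (n + 1))
    (h : oddDegree n i ≡ oddDegree n j [MOD (n + 1)]) : i = j := by
  refine eq_of_evenDegree_modEq i j (Nat.ModEq.add_right_cancel h ?_)
  rw [evenDegree_add_oddDegree, evenDegree_add_oddDegree]

theorem exists_evenDegree (hm : 1 ≤ m) (hn : 1 ≤ n) {g : ℂ[X][X]} (hg : g ∈ evenPart m n) :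
    ∃ i q, g.natDegree = q * (n + 1) + evenDegree n i := by
  rcases natDegree_of_mem_evenPart hm hn hg with h | h
  · exact ⟨0, 0, by rw [h, evenDegree]; simp⟩
  · have h1 := Nat.div_add_mod' g.natDegree (n + 1)
    have h2 := Nat.mod_lt g.natDegree (Nat.succ_pos n)
    set q := g.natDegree / (n + 1)
    set r := g.natDegree % (n + 1)
    by_cases hr : r = 0
    · exact ⟨0, q, by rw [evenDegree]; simp; omega⟩
    · have hq : q ≠ 0 := by rintro hq; rw [hq] at h1; omega
      obtain ⟨q', hq'⟩ := Nat.exists_eq_succ_of_ne_zero hq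
      refine ⟨⟨r, h2⟩, q', ?_⟩
      rw [evenDegree, if_neg hr, ← h1, hq', Nat.succ_mul]
      ring

theorem exists_oddDegree (hm : 1 ≤ m) (hn : 1 ≤ n) {h : ℂ[X][X]} (hh : h ∈ oddPart m n)
    (h0 : h ≠ 0) : ∃ i q, h.natDegree = q * (n + 1) + oddDegree n i := by
  obtain ⟨ha, hb⟩ := natDegree_of_mem_oddPart hm hn hh h0
  obtain ⟨e, he⟩ := Nat.exists_eq_add_of_le' ha
  have h1 := Nat.div_add_mod' e (n + 1)
  have h2 := Nat.mod_lt e (Nat.succ_pos n)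
  set q := e / (n + 1)
  set r := e % (n + 1)
  by_cases hr : r = n
  · have hq : q ≠ 0 := by rintro hq; rw [hq] at h1; omega
    obtain ⟨q', hq'⟩ := Nat.exists_eq_succ_of_ne_zero hq
    refine ⟨0, q', ?_⟩
    rw [oddDegree, evenDegree, if_pos (by simp)]
    rw [hq', Nat.succ_mul] at h1
    omega
  · refine ⟨⟨n - r, by omega⟩, q, ?_⟩
    rw [oddDegree, evenDegree, if_neg (by simp only; omega)]
    simp only
    omega

end EchelonBasis

/-! ### Polynomials on the plane as elements of `ℂ[ρ][X]` -/

section Plane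

/-- The ring homomorphism `ℂ[ρ][X] → ℂ[x₁, x₂]` with `ρ ↦ x₁² + x₂²` and `X ↦ x₂`. -/
noncomputable def planeHom : ℂ[X][X] →+* MvPolynomial (Fin 2) ℂ :=
  eval₂RingHom (aeval (MvPolynomial.X 0 ^ 2 + MvPolynomial.X 1 ^ 2 : MvPolynomial (Fin 2) ℂ) :
    ℂ[X] →ₐ[ℂ] MvPolynomial (Fin 2) ℂ).toRingHom (MvPolynomial.X 1)

theorem planeHom_C (c : ℂ[X]) : planeHom (C c) =
    aeval (MvPolynomial.X 0 ^ 2 + MvPolynomial.X 1 ^ 2 : MvPolynomial (Fin 2) ℂ) c :=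
  eval₂_C _ _

theorem planeHom_X : planeHom X = MvPolynomial.X 1 := eval₂_X _ _

theorem planeHom_C_X : planeHom (C X) = MvPolynomial.X 0 ^ 2 + MvPolynomial.X 1 ^ 2 := by
  rw [planeHom_C, aeval_X]

theorem planeHom_C_C (a : ℂ) : planeHom (C (C a)) = MvPolynomial.C a := by
  rw [planeHom_C, aeval_C]; rfl

theorem planeHom_C_X_sub_X_sq : planeHom (C X - X ^ 2) = MvPolynomial.X 0 ^ 2 := by
  rw [map_sub, map_pow, planeHom_C_X, planeHom_X]; ring

theorem eval_planeHom (v : Fin 2 → ℂ) (g : ℂ[X][X]) :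
    MvPolynomial.eval v (planeHom g) = g.evalEval (v 0 ^ 2 + v 1 ^ 2) (v 1) := by
  have h : (MvPolynomial.eval v).comp planeHom =
      evalEvalRingHom (v 0 ^ 2 + v 1 ^ 2) (v 1) := by
    refine Polynomial.ringHom_ext' (Polynomial.ringHom_ext' (RingHom.ext fun a => ?_) ?_) ?_
    · change MvPolynomial.eval v (planeHom (C (C a))) = (C (C a)).evalEval _ _
      rw [planeHom_C_C, MvPolynomial.eval_C, evalEval_C, eval_C]
    · change MvPolynomial.eval v (planeHom (C X)) = (C X).evalEval _ _
      rw [planeHom_C_X, evalEval_C, eval_X]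
      simp
    · change MvPolynomial.eval v (planeHom X) = X.evalEval _ _
      rw [planeHom_X, evalEval_X, MvPolynomial.eval_X]
  exact RingHom.congr_fun h g

theorem eq_zero_of_evalEval_eq_zero {g : ℂ[X][X]} (h : ∀ r x, g.evalEval r x = 0) : g = 0 := by
  refine eq_zero_of_infinite_isRoot g (Set.infinite_of_injective_forall_mem
    (f := (C : ℂ → ℂ[X])) C_injective fun x => ?_)
  exact Polynomial.funext fun r => (h r x).trans eval_zero.symm

/-- The decomposition `ℂ[x₁, x₂] = ℂ[ρ, x₂] ⊕ x₁ ℂ[ρ, x₂]` exists. -/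
theorem exists_eq_planeHom_add (p : MvPolynomial (Fin 2) ℂ) :
    ∃ g h, p = planeHom g + MvPolynomial.X 0 * planeHom h := by
  induction p using MvPolynomial.induction_on with
  | C a => exact ⟨C (C a), 0, by rw [planeHom_C_C, map_zero, mul_zero, add_zero]⟩
  | add p q hp hq =>
    obtain ⟨g, h, rfl⟩ := hp
    obtain ⟨g', h', rfl⟩ := hq
    exact ⟨g + g', h + h', by rw [map_add, map_add]; ring⟩
  | mul_X p i hp =>
    obtain ⟨g, h, rfl⟩ := hp
    fin_cases i
    · refine ⟨(C X - X ^ 2) * h, g, ?_⟩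
      rw [map_mul, planeHom_C_X_sub_X_sq]
      simp only [Fin.zero_eta]
      ring
    · refine ⟨g * X, h * X, ?_⟩
      rw [map_mul, map_mul, planeHom_X]
      simp only [Fin.mk_one]
      ring

/-- The decomposition `ℂ[x₁, x₂] = ℂ[ρ, x₂] ⊕ x₁ ℂ[ρ, x₂]` is unique. -/
theorem planeHom_add_eq_zero {g h : ℂ[X][X]}
    (hp : planeHom g + MvPolynomial.X 0 * planeHom h = 0) : g = 0 ∧ h = 0 := by
  have key : ∀ y x : ℂ, g.evalEval (y ^ 2 + x ^ 2) x + y * h.evalEval (y ^ 2 + x ^ 2) x = 0 :=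
    fun y x => by
      have := congrArg (MvPolynomial.eval ![y, x]) hp
      simpa [eval_planeHom] using this
  have hg : g = 0 := by
    refine eq_zero_of_evalEval_eq_zero fun r x => ?_
    obtain ⟨y, hy⟩ := IsAlgClosed.exists_pow_nat_eq (r - x ^ 2) two_pos
    have h1 := key y x
    have h2 := key (-y) x
    rw [neg_sq] at h2
    rw [show y ^ 2 + x ^ 2 = r by rw [hy]; ring] at h1 h2
    linear_combination (1 / 2 : ℂ) * h1 + (1 / 2 : ℂ) * h2
  refine ⟨hg, ?_⟩
  rw [hg, map_zero, zero_add] at hp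
  have hh := (mul_eq_zero.mp hp).resolve_left (MvPolynomial.X_ne_zero 0)
  refine eq_zero_of_evalEval_eq_zero fun r x => ?_
  obtain ⟨y, hy⟩ := IsAlgClosed.exists_pow_nat_eq (r - x ^ 2) two_pos
  have := congrArg (MvPolynomial.eval ![y, x]) hh
  rw [eval_planeHom, map_zero] at this
  simp only [Matrix.cons_val_zero, Matrix.cons_val_one] at this
  rwa [show y ^ 2 + x ^ 2 = r by rw [hy]; ring] at this

theorem planeHom_isHomogeneous {g : ℂ[X][X]} {d : ℕ} (hg : HasWeight g d) :
    (planeHom g).IsHomogeneous d := by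
  have h : planeHom g = ∑ i ∈ g.support, ∑ j ∈ (g.coeff i).support,
      MvPolynomial.C ((g.coeff i).coeff j) *
        (MvPolynomial.X 0 ^ 2 + MvPolynomial.X 1 ^ 2) ^ j * MvPolynomial.X 1 ^ i := by
    conv_lhs => rw [← g.sum_C_mul_X_pow_eq, Polynomial.sum, map_sum]
    refine Finset.sum_congr rfl fun i _ => ?_
    rw [map_mul, map_pow, planeHom_X, planeHom_C, aeval_def, eval₂_eq_sum, Polynomial.sum,
      Finset.sum_mul]
    rfl
  rw [h]
  refine MvPolynomial.IsHomogeneous.sum _ _ _ fun i _ =>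
    MvPolynomial.IsHomogeneous.sum _ _ _ fun j hj => ?_
  rw [← hg i j (mem_support_iff.mp hj), show i + 2 * j = 0 + 2 * j + i by ring]
  exact ((MvPolynomial.isHomogeneous_C _ _).mul
    (((MvPolynomial.isHomogeneous_X_pow 0 2).add
      (MvPolynomial.isHomogeneous_X_pow 1 2)).pow j)).mul (MvPolynomial.isHomogeneous_X_pow 1 i)

/-- The angular derivative `x₂ ∂/∂x₁ - x₁ ∂/∂x₂`. On a line `(α, x) = 0` through the origin it is a
multiple of `∂_α`. -/
noncomputable def angularDeriv :
    Derivation ℂ (MvPolynomial (Fin 2) ℂ) (MvPolynomial (Fin 2) ℂ) :=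
  (MvPolynomial.X 1 : MvPolynomial (Fin 2) ℂ) • MvPolynomial.pderiv 0 -
    (MvPolynomial.X 0 : MvPolynomial (Fin 2) ℂ) • MvPolynomial.pderiv 1

theorem angularDeriv_apply (p : MvPolynomial (Fin 2) ℂ) :
    angularDeriv p = MvPolynomial.X 1 * MvPolynomial.pderiv 0 p -
      MvPolynomial.X 0 * MvPolynomial.pderiv 1 p := rfl

theorem angularDeriv_X_zero : angularDeriv (MvPolynomial.X 0) = MvPolynomial.X 1 := by
  rw [angularDeriv_apply, MvPolynomial.pderiv_X_self, MvPolynomial.pderiv_X_of_ne (by decide)]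
  ring

theorem angularDeriv_X_one : angularDeriv (MvPolynomial.X 1) = -MvPolynomial.X 0 := by
  rw [angularDeriv_apply, MvPolynomial.pderiv_X_self, MvPolynomial.pderiv_X_of_ne (by decide)]
  ring

theorem angularDeriv_planeHom (g : ℂ[X][X]) :
    angularDeriv (planeHom g) = -(MvPolynomial.X 0 * planeHom (derivative g)) := by
  induction g using Polynomial.induction_on' with
  | add p q hp hq => rw [map_add, map_add, hp, hq, derivative_add, map_add]; ring
  | monomial i c =>
    have hc : angularDeriv (planeHom (C c)) = 0 := by
      have hρ : angularDeriv (MvPolynomial.X 0 ^ 2 + MvPolynomial.X 1 ^ 2) = 0 := by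
        rw [map_add, Derivation.leibniz_pow, Derivation.leibniz_pow, angularDeriv_X_zero,
          angularDeriv_X_one]
        simp only [smul_eq_mul, nsmul_eq_mul]
        ring
      rw [planeHom_C, Derivation.map_aeval, hρ, smul_zero]
    rw [← C_mul_X_pow_eq_monomial, map_mul, Derivation.leibniz, hc, smul_zero, add_zero, map_pow,
      planeHom_X, Derivation.leibniz_pow, angularDeriv_X_one, derivative_C_mul_X_pow,
      C_mul, map_mul, map_mul, map_pow, planeHom_X, map_natCast, map_natCast]
    simp only [smul_eq_mul, nsmul_eq_mul]
    ring

/-- The angular derivative of a polynomial whose odd part is divisible by `x₁^(2m+1)`. -/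
theorem angularDeriv_planeHom_add (m : ℕ) (g h : ℂ[X][X]) :
    angularDeriv (planeHom g + MvPolynomial.X 0 ^ (2 * m + 1) * planeHom h) =
      -(MvPolynomial.X 0 * planeHom (derivative g)) + MvPolynomial.X 0 ^ (2 * m) *
        planeHom ((((2 * m : ℕ) : ℂ[X][X]) + 1) * X * h - (C X - X ^ 2) * derivative h) := by
  rw [map_add, Derivation.leibniz, angularDeriv_planeHom, angularDeriv_planeHom,
    Derivation.leibniz_pow, angularDeriv_X_zero, map_sub, map_mul planeHom (C X - X ^ 2),
    planeHom_C_X_sub_X_sq, map_mul, map_mul, map_add, map_one, map_natCast, planeHom_X]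
  simp only [smul_eq_mul, nsmul_eq_mul, Nat.add_sub_cancel]
  push_cast
  ring

theorem dirDeriv_apply (α : Fin 2 → ℂ) (p : MvPolynomial (Fin 2) ℂ) :
    dirDeriv α p = MvPolynomial.C (α 0) * MvPolynomial.pderiv 0 p +
      MvPolynomial.C (α 1) * MvPolynomial.pderiv 1 p := by
  rw [dirDeriv, Fin.sum_univ_two, Derivation.add_apply, Derivation.smul_apply,
    Derivation.smul_apply, MvPolynomial.smul_eq_C_mul, MvPolynomial.smul_eq_C_mul]

/-- At the point `t (-σ, c)` the angular derivative is `t` times the derivative along `(c, σ)`. -/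
theorem eval_angularDeriv (c σ t : ℂ) (p : MvPolynomial (Fin 2) ℂ) :
    MvPolynomial.eval ![t * -σ, t * c] (angularDeriv p) =
      t * MvPolynomial.eval ![t * -σ, t * c] (dirDeriv ![c, σ] p) := by
  rw [angularDeriv_apply, dirDeriv_apply]
  simp
  ring

/-- A polynomial vanishing on a punctured line through the origin vanishes at the origin. -/
theorem eval_eq_zero_of_punctured (p : MvPolynomial (Fin 2) ℂ) (a b : ℂ)
    (h : ∀ t : ℂ, t ≠ 0 → MvPolynomial.eval ![t * a, t * b] p = 0) (t : ℂ) :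
    MvPolynomial.eval ![t * a, t * b] p = 0 := by
  have hcont : Continuous fun t : ℂ => MvPolynomial.eval ![t * a, t * b] p :=
    (MvPolynomial.continuous_eval p).comp (by fun_prop)
  have hdense : Dense ({0}ᶜ : Set ℂ) := dense_compl_singleton 0
  exact congrFun (hcont.ext_on hdense continuous_const fun t ht => h t ht) t

end Plane

/-! ### Quasi-invariance along the line `x₁ = 0` -/

section Reflection

theorem dirDeriv_one_zero (p : MvPolynomial (Fin 2) ℂ) :
    dirDeriv ![1, 0] p = MvPolynomial.pderiv 0 p := by
  rw [dirDeriv_apply]; simp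

theorem dirDeriv_X_zero_pow_mul (k : ℕ) (q : MvPolynomial (Fin 2) ℂ) :
    dirDeriv ![1, 0] (MvPolynomial.X 0 ^ (k + 1) * q) =
      MvPolynomial.C ((k : ℂ) + 1) * (MvPolynomial.X 0 ^ k * q) +
        MvPolynomial.X 0 ^ (k + 1) * dirDeriv ![1, 0] q := by
  rw [Derivation.leibniz, Derivation.leibniz_pow, dirDeriv_one_zero (MvPolynomial.X 0),
    MvPolynomial.pderiv_X_self, MvPolynomial.C_add, map_natCast, MvPolynomial.C_1]
  simp only [smul_eq_mul, nsmul_eq_mul, Nat.add_sub_cancel]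
  push_cast; ring

theorem iterate_dirDeriv_C_mul (α : Fin 2 → ℂ) (j : ℕ) (a : ℂ) (q : MvPolynomial (Fin 2) ℂ) :
    (dirDeriv α)^[j] (MvPolynomial.C a * q) = MvPolynomial.C a * (dirDeriv α)^[j] q := by
  induction j generalizing q with
  | zero => rfl
  | succ j ih =>
    rw [Function.iterate_succ_apply, Function.iterate_succ_apply, ← ih]
    congr 1
    rw [← MvPolynomial.smul_eq_C_mul, Derivation.map_smul, MvPolynomial.smul_eq_C_mul]

theorem eval_iterate_dirDeriv_X_zero_pow_mul {v : Fin 2 → ℂ} (hv : v 0 = 0) (j k : ℕ) (h : j < k)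
    (q : MvPolynomial (Fin 2) ℂ) :
    MvPolynomial.eval v ((dirDeriv ![1, 0])^[j] (MvPolynomial.X 0 ^ k * q)) = 0 := by
  induction j generalizing k q with
  | zero =>
    rw [Function.iterate_zero, id, map_mul, map_pow, MvPolynomial.eval_X, hv, zero_pow (by omega),
      zero_mul]
  | succ j ih =>
    obtain ⟨k, rfl⟩ := Nat.exists_eq_add_of_le' (show 1 ≤ k by omega)
    rw [Function.iterate_succ_apply, dirDeriv_X_zero_pow_mul, iterate_map_add,
      iterate_dirDeriv_C_mul, map_add, map_mul, ih k (by omega), ih (k + 1) (by omega)]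
    ring

theorem eval_iterate_dirDeriv_X_zero_pow_mul_self {v : Fin 2 → ℂ} (hv : v 0 = 0) (k : ℕ)
    (q : MvPolynomial (Fin 2) ℂ) :
    MvPolynomial.eval v ((dirDeriv ![1, 0])^[k] (MvPolynomial.X 0 ^ k * q)) =
      k.factorial * MvPolynomial.eval v q := by
  induction k generalizing q with
  | zero => simp
  | succ k ih =>
    rw [Function.iterate_succ_apply, dirDeriv_X_zero_pow_mul, iterate_map_add,
      iterate_dirDeriv_C_mul, map_add, map_mul, ih,
      eval_iterate_dirDeriv_X_zero_pow_mul hv k (k + 1) (by omega), MvPolynomial.eval_C,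
      Nat.factorial_succ]
    push_cast; ring

theorem planeHom_mem_subalgebra (B : Subalgebra ℂ (MvPolynomial (Fin 2) ℂ))
    (h0 : MvPolynomial.X 0 ^ 2 + MvPolynomial.X 1 ^ 2 ∈ B) (h1 : MvPolynomial.X 1 ∈ B)
    (g : ℂ[X][X]) : planeHom g ∈ B := by
  induction g using Polynomial.induction_on' with
  | add p q hp hq => rw [map_add]; exact B.add_mem hp hq
  | monomial i c =>
    rw [← C_mul_X_pow_eq_monomial, map_mul, map_pow, planeHom_X]
    refine B.mul_mem ?_ (B.pow_mem h1 i)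
    rw [planeHom_C]
    exact Algebra.adjoin_le (Set.singleton_subset_iff.mpr h0) (aeval_mem_adjoin_singleton ℂ _)

/-- Polynomials even in `x₁` are quasi-invariant of any multiplicity along `x₁ = 0`. -/
theorem eval_iterate_dirDeriv_planeHom {v : Fin 2 → ℂ} (hv : v 0 = 0) {s : ℕ} (hs : 1 ≤ s)
    (g : ℂ[X][X]) :
    MvPolynomial.eval v ((dirDeriv ![1, 0])^[2 * s - 1] (planeHom g)) = 0 := by
  let A : PlaneConfiguration 0 := ⟨fun _ => ![1, 0], fun _ => s⟩
  have hconst : ∀ (k : ℕ) (a : ℂ), (dirDeriv ![1, 0])^[k + 1] (MvPolynomial.C a) = 0 :=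
    fun k a => by
      rw [Function.iterate_succ_apply, ← MvPolynomial.algebraMap_eq, Derivation.map_algebraMap,
        iterate_map_zero]
  have hD1 : dirDeriv ![1, 0] (MvPolynomial.X 1) = 0 := by
    rw [dirDeriv_one_zero, MvPolynomial.pderiv_X_of_ne (by decide)]
  have hD0 : dirDeriv ![1, 0] (MvPolynomial.X 0 ^ 2 + MvPolynomial.X 1 ^ 2) =
      MvPolynomial.C 2 * MvPolynomial.X 0 := by
    rw [map_add, Derivation.leibniz_pow, Derivation.leibniz_pow, hD1, dirDeriv_one_zero,
      MvPolynomial.pderiv_X_self]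
    rw [show (MvPolynomial.C 2 : MvPolynomial (Fin 2) ℂ) = 2 from map_ofNat _ 2]
    simp [two_mul]
  have h1 : MvPolynomial.X 1 ∈ A.quasiInvariants := by
    intro i t ht _ x _
    obtain ⟨t, rfl⟩ := Nat.exists_eq_add_of_le' ht
    rw [show 2 * (t + 1) - 1 = 2 * t + 1 by omega, Function.iterate_succ_apply]
    change MvPolynomial.eval x ((dirDeriv ![1, 0])^[2 * t] (dirDeriv ![1, 0] _)) = 0
    rw [hD1, iterate_map_zero, map_zero]
  have h0 : MvPolynomial.X 0 ^ 2 + MvPolynomial.X 1 ^ 2 ∈ A.quasiInvariants := by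
    intro i t ht _ x hx
    have hx0 : x 0 = 0 := by
      change ![(1 : ℂ), 0] ⬝ᵥ x = 0 at hx
      simpa [dotProduct, Fin.sum_univ_two] using hx
    obtain ⟨t, rfl⟩ := Nat.exists_eq_add_of_le' ht
    rw [show 2 * (t + 1) - 1 = 2 * t + 1 by omega, Function.iterate_succ_apply]
    change MvPolynomial.eval x ((dirDeriv ![1, 0])^[2 * t] (dirDeriv ![1, 0] _)) = 0
    rw [hD0, iterate_dirDeriv_C_mul]
    cases t with
    | zero => simp [hx0]
    | succ t =>
      rw [show 2 * (t + 1) = 2 * t + 1 + 1 by ring, Function.iterate_succ_apply, dirDeriv_one_zero,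
        MvPolynomial.pderiv_X_self, ← MvPolynomial.C_1, hconst, mul_zero, map_zero]
  refine planeHom_mem_subalgebra A.quasiInvariants h0 h1 g 0 s hs le_rfl v ?_
  change ![(1 : ℂ), 0] ⬝ᵥ v = 0
  simp [dotProduct, Fin.sum_univ_two, hv]

/-- Divisibility by `ρ - X²`, that is by `x₁²`, can be tested on the line `x₁ = 0`. -/
theorem C_X_sub_X_sq_dvd {h : ℂ[X][X]} (hh : ∀ x : ℂ, h.evalEval (x ^ 2) x = 0) :
    C X - X ^ 2 ∣ h := by
  rw [← neg_dvd, neg_sub]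
  have hmon : (X ^ 2 - C X : ℂ[X][X]).Monic := monic_X_pow_sub_C _ two_ne_zero
  have hdeg : (X ^ 2 - C X : ℂ[X][X]).natDegree = 2 := natDegree_X_pow_sub_C
  rw [← modByMonic_eq_zero_iff_dvd hmon]
  obtain ⟨a, b, hab⟩ := exists_eq_X_add_C_of_natDegree_le_one (p := h %ₘ (X ^ 2 - C X)) (by
    have := natDegree_modByMonic_lt h hmon (fun h1 => by rw [h1] at hdeg; simp at hdeg)
    omega)
  have hval : ∀ x : ℂ, a.eval (x ^ 2) * x + b.eval (x ^ 2) = 0 := fun x => by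
    have h1 := congrArg (evalEval (x ^ 2) x) (modByMonic_add_div h (X ^ 2 - C X))
    rw [evalEval_add, evalEval_mul, evalEval_sub, evalEval_pow, evalEval_X, evalEval_C, eval_X,
      sub_self, zero_mul, add_zero, hh, hab, evalEval_add, evalEval_mul, evalEval_C, evalEval_C,
      evalEval_X] at h1
    exact h1
  have hb : b = 0 := Polynomial.funext fun r => by
    obtain ⟨x, rfl⟩ := IsAlgClosed.exists_pow_nat_eq r two_pos
    have h1 := hval x
    have h2 := hval (-x)
    rw [neg_sq] at h2
    rw [eval_zero]
    linear_combination (1 / 2 : ℂ) * h1 + (1 / 2 : ℂ) * h2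
  have ha : X * a = 0 := Polynomial.funext fun r => by
    obtain ⟨x, rfl⟩ := IsAlgClosed.exists_pow_nat_eq r two_pos
    have h1 := hval x
    rw [hb, eval_zero, add_zero] at h1
    rw [eval_mul, eval_X, eval_zero]
    linear_combination x * h1
  rw [hab, hb, (mul_eq_zero.mp ha).resolve_left X_ne_zero]
  simp

/-- Quasi-invariance of multiplicity `m` along `x₁ = 0` says that the odd part in `x₁` is divisible
by `x₁^(2m+1)`. -/
theorem quasiInvariant_line_iff (m : ℕ) (p : MvPolynomial (Fin 2) ℂ) :
    (∀ s, 1 ≤ s → s ≤ m → ∀ v : Fin 2 → ℂ, v 0 = 0 →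
      MvPolynomial.eval v ((dirDeriv ![1, 0])^[2 * s - 1] p) = 0) ↔
    ∃ g h, p = planeHom g + MvPolynomial.X 0 ^ (2 * m + 1) * planeHom h := by
  constructor
  · intro hp
    induction m with
    | zero =>
      obtain ⟨g, h, rfl⟩ := exists_eq_planeHom_add p
      exact ⟨g, h, by rw [mul_zero, zero_add, pow_one]⟩
    | succ m ih =>
      obtain ⟨g, h, rfl⟩ := ih fun s h1 h2 => hp s h1 (by omega)
      obtain ⟨h', rfl⟩ : C X - X ^ 2 ∣ h := C_X_sub_X_sq_dvd fun x => by
        have h1 := hp (m + 1) (by omega) le_rfl ![0, x] rfl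
        rw [iterate_map_add, map_add, eval_iterate_dirDeriv_planeHom rfl (by omega), zero_add,
          show 2 * (m + 1) - 1 = 2 * m + 1 by omega,
          eval_iterate_dirDeriv_X_zero_pow_mul_self rfl, eval_planeHom] at h1
        have h2 := (mul_eq_zero.mp h1).resolve_left
          (by exact_mod_cast (2 * m + 1).factorial_ne_zero)
        simpa using h2
      refine ⟨g, h', ?_⟩
      rw [map_mul, planeHom_C_X_sub_X_sq]
      ring
  · rintro ⟨g, h, rfl⟩ s hs hsm v hv
    rw [iterate_map_add, map_add, eval_iterate_dirDeriv_planeHom hv hs,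
      eval_iterate_dirDeriv_X_zero_pow_mul hv _ _ (by omega), add_zero]

end Reflection

/-! ### Characterization of the quasi-invariants -/

section Characterization

variable {m n : ℕ}

/-- At the zeros of `Γ` the Gegenbauer equation turns the condition on the odd part into the
vanishing of the residues of `h / Γ²`. -/
theorem gegenbauerForm_residue (hm : 1 ≤ m) {r x : ℂ}
    (hx : (gegenbauerForm m n).evalEval r x = 0) (h : ℂ[X][X]) :
    (derivative (gegenbauerForm m n)).evalEval r x *
      ((((2 * m : ℕ) : ℂ[X][X]) + 1) * X * h - (C X - X ^ 2) * derivative h).evalEval r x =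
    (r - x ^ 2) * (derivative (derivative (gegenbauerForm m n)) * h -
      derivative (gegenbauerForm m n) * derivative h).evalEval r x := by
  have hode := congrArg (evalEval r x) (gegenbauerForm_ode (n := n) hm)
  simp only [evalEval_add, evalEval_sub, evalEval_mul, evalEval_pow, evalEval_C, eval_X,
    evalEval_X, evalEval_natCast, evalEval_one, evalEval_zero, hx] at hode ⊢
  linear_combination (-h.evalEval r x) * hode

theorem gegenbauerForm_root (hm : 1 ≤ m) (hn : 1 ≤ n) {r x : ℂ} (hr : r ≠ 0)
    (hx : (gegenbauerForm m n).evalEval r x = 0) :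
    (derivative (gegenbauerForm m n)).evalEval r x ≠ 0 ∧ r - x ^ 2 ≠ 0 := by
  rw [← map_evalRingHom_eval] at hx
  have := gegenbauerForm_map_root hm hn hr hx
  rwa [derivative_map, map_evalRingHom_eval] at this

theorem eval_angularDeriv_planeHom_add (v : Fin 2 → ℂ) (g h : ℂ[X][X]) :
    MvPolynomial.eval v
        (angularDeriv (planeHom g + MvPolynomial.X 0 ^ (2 * m + 1) * planeHom h)) =
      -(v 0 * (derivative g).evalEval (v 0 ^ 2 + v 1 ^ 2) (v 1)) + v 0 ^ (2 * m) *
        ((((2 * m : ℕ) : ℂ[X][X]) + 1) * X * h - (C X - X ^ 2) * derivative h).evalEval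
          (v 0 ^ 2 + v 1 ^ 2) (v 1) := by
  rw [angularDeriv_planeHom_add, map_add, map_neg, map_mul, map_mul, map_pow, MvPolynomial.eval_X,
    eval_planeHom, eval_planeHom]

/-- The conditions on the lines of multiplicity one, for a polynomial quasi-invariant along
`x₁ = 0`. The reflection `x₁ ↦ -x₁` separates the even and the odd part. -/
theorem forall_eval_angularDeriv_iff (hm : 1 ≤ m) (hn : 1 ≤ n) (g h : ℂ[X][X]) :
    (∀ y x : ℂ, y ^ 2 + x ^ 2 ≠ 0 → (gegenbauerForm m n).evalEval (y ^ 2 + x ^ 2) x = 0 →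
      MvPolynomial.eval ![y, x]
        (angularDeriv (planeHom g + MvPolynomial.X 0 ^ (2 * m + 1) * planeHom h)) = 0) ↔
    g ∈ evenPart m n ∧ h ∈ oddPart m n := by
  constructor
  · intro H
    have key : ∀ r x : ℂ, r ≠ 0 → (gegenbauerForm m n).evalEval r x = 0 →
        (derivative g).evalEval r x = 0 ∧
        ((((2 * m : ℕ) : ℂ[X][X]) + 1) * X * h -
          (C X - X ^ 2) * derivative h).evalEval r x = 0 := by
      intro r x hr hx
      obtain ⟨y, hy⟩ := IsAlgClosed.exists_pow_nat_eq (r - x ^ 2) two_pos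
      have hy0 : y ≠ 0 := by
        rintro rfl
        exact (gegenbauerForm_root hm hn hr hx).2 (by rw [← hy]; simp)
      have hyr : y ^ 2 + x ^ 2 = r := by rw [hy]; ring
      have h1 := H y x (by rwa [hyr]) (by rwa [hyr])
      have h2 := H (-y) x (by rwa [neg_sq, hyr]) (by rwa [neg_sq, hyr])
      rw [eval_angularDeriv_planeHom_add] at h1 h2
      simp only [Matrix.cons_val_zero, Matrix.cons_val_one, neg_sq, hyr,
        (even_two_mul m).neg_pow] at h1 h2
      constructor
      · have : y * (derivative g).evalEval r x = 0 := by
          linear_combination (1 / 2 : ℂ) * h2 - (1 / 2 : ℂ) * h1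
        exact (mul_eq_zero.mp this).resolve_left hy0
      · have : y ^ (2 * m) * ((((2 * m : ℕ) : ℂ[X][X]) + 1) * X * h -
            (C X - X ^ 2) * derivative h).evalEval r x = 0 := by
          linear_combination (1 / 2 : ℂ) * h1 + (1 / 2 : ℂ) * h2
        exact (mul_eq_zero.mp this).resolve_left (pow_ne_zero _ hy0)
    refine ⟨gegenbauerForm_dvd hm hn fun r x hr hx => (key r x hr hx).1,
      gegenbauerForm_dvd hm hn fun r x hr hx => ?_⟩
    have h1 := gegenbauerForm_residue hm hx h
    rw [(key r x hr hx).2, mul_zero] at h1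
    exact (mul_eq_zero.mp h1.symm).resolve_left (gegenbauerForm_root hm hn hr hx).2
  · rintro ⟨hg, hh⟩ y x hr hx
    have h1 : (derivative g).evalEval (y ^ 2 + x ^ 2) x = 0 := by
      obtain ⟨u, hu⟩ := mem_evenPart.mp hg
      rw [hu, evalEval_mul, hx, zero_mul]
    have h2 := gegenbauerForm_residue hm hx h
    obtain ⟨u, hu⟩ := mem_oddPart.mp hh
    rw [hu, evalEval_mul, hx, zero_mul, mul_zero] at h2
    have h3 := (mul_eq_zero.mp h2).resolve_left (gegenbauerForm_root hm hn hr hx).1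
    rw [eval_angularDeriv_planeHom_add]
    simp only [Matrix.cons_val_zero, Matrix.cons_val_one]
    rw [h1, h3]
    ring

theorem dirDeriv_smul_pair (ε c σ : ℂ) (p : MvPolynomial (Fin 2) ℂ) :
    dirDeriv ![ε * c, ε * σ] p = MvPolynomial.C ε * dirDeriv ![c, σ] p := by
  rw [dirDeriv_apply, dirDeriv_apply]
  simp only [Matrix.cons_val_zero, Matrix.cons_val_one, MvPolynomial.C_mul]
  ring

/-- The quasi-invariants are the polynomials `g + x₁^(2m+1) h` with `g` in `evenPart` and `h` in
`oddPart`. -/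
theorem PlaneConfiguration.mem_quasiInvariants_iff (hm : 1 ≤ m) (hn : 1 ≤ n)
    {A : PlaneConfiguration n} (hA : A.IsAm1n m) (p : MvPolynomial (Fin 2) ℂ) :
    p ∈ A.quasiInvariants ↔ ∃ g ∈ evenPart m n, ∃ h ∈ oddPart m n,
      p = planeHom g + MvPolynomial.X 0 ^ (2 * m + 1) * planeHom h := by
  obtain ⟨hv0, hm0, hm1, φ, hφ, hesymm⟩ := hA
  have hline : ∀ v : Fin 2 → ℂ, ![(1 : ℂ), 0] ⬝ᵥ v = v 0 := fun v => by
    simp [dotProduct, Fin.sum_univ_two]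
  have hdot : ∀ (j : Fin n) (v : Fin 2 → ℂ), A.vec j.succ ⬝ᵥ v =
      Complex.cos (φ j) * v 0 + Complex.sin (φ j) * v 1 := fun j v => by
    rw [hφ j]; simp [dotProduct, Fin.sum_univ_two]
  have hmem : p ∈ A.quasiInvariants ↔
      (∀ s, 1 ≤ s → s ≤ m → ∀ v : Fin 2 → ℂ, v 0 = 0 →
        MvPolynomial.eval v ((dirDeriv ![1, 0])^[2 * s - 1] p) = 0) ∧
      ∀ (j : Fin n) (v : Fin 2 → ℂ), Complex.cos (φ j) * v 0 + Complex.sin (φ j) * v 1 = 0 →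
        MvPolynomial.eval v (dirDeriv ![Complex.cos (φ j), Complex.sin (φ j)] p) = 0 := by
    constructor
    · intro hp
      refine ⟨fun s h1 h2 v hv => ?_, fun j v hv => ?_⟩
      · have := hp 0 s h1 (by rwa [hm0]) v (by rw [hv0, hline, hv])
        rwa [hv0] at this
      · have := hp j.succ 1 le_rfl (by rw [hm1]) v (by rw [hdot, hv])
        rwa [hφ] at this
    · rintro ⟨h1, h2⟩ i
      refine Fin.cases ?_ (fun j => ?_) i
      · intro s hs hsm v hv
        rw [hv0] at hv ⊢
        rw [hm0] at hsm
        exact h1 s hs hsm v (by rwa [hline] at hv)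
      · intro s hs hsm v hv
        rw [hm1] at hsm
        obtain rfl : s = 1 := le_antisymm hsm hs
        rw [hdot] at hv
        rw [hφ]
        exact h2 j v hv
  rw [hmem, quasiInvariant_line_iff]
  constructor
  · rintro ⟨⟨g, h, rfl⟩, hlines⟩
    have := (forall_eval_angularDeriv_iff hm hn g h).mp fun y x hr hx => by
      obtain ⟨t, ht⟩ := IsAlgClosed.exists_pow_nat_eq (y ^ 2 + x ^ 2) two_pos
      have ht0 : t ≠ 0 := by rintro rfl; exact hr (by rw [← ht]; simp)
      have hunit : (x / t) ^ 2 + (-(y / t)) ^ 2 = 1 := by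
        field_simp; rw [ht]; ring
      have hroot : (gegenbauer m n).eval (x / t) = 0 := by
        have h1 := gegenbauerForm_evalEval (m := m) (n := n) t (x / t)
        rw [ht, mul_div_cancel₀ x ht0, hx] at h1
        exact (mul_eq_zero.mp h1.symm).resolve_left (pow_ne_zero _ ht0)
      obtain ⟨j, ε, -, hc, hs⟩ := (eval_gegenbauer_eq_zero_iff hm φ hesymm hunit).mp hroot
      have hpt : (![y, x] : Fin 2 → ℂ) = ![t * -(-(y / t)), t * (x / t)] := by
        rw [neg_neg, mul_div_cancel₀ y ht0, mul_div_cancel₀ x ht0]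
      rw [hpt, eval_angularDeriv, hc, hs, dirDeriv_smul_pair, map_mul, hlines j _ (by
        simp only [Matrix.cons_val_zero, Matrix.cons_val_one]; ring), mul_zero, mul_zero]
    exact ⟨g, this.1, h, this.2, rfl⟩
  · rintro ⟨g, hg, h, hh, rfl⟩
    refine ⟨⟨g, h, rfl⟩, fun j v hv => ?_⟩
    have hang := (forall_eval_angularDeriv_iff hm hn g h).mpr ⟨hg, hh⟩
    set c := Complex.cos (φ j) with hc
    set σ := Complex.sin (φ j) with hs
    have hunit : c ^ 2 + σ ^ 2 = 1 := by
      rw [add_comm]; exact Complex.sin_sq_add_cos_sq (φ j)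
    have hroot : (gegenbauer m n).eval c = 0 :=
      (eval_gegenbauer_eq_zero_iff hm φ hesymm hunit).mpr
        ⟨j, 1, one_pow 2, (one_mul _).symm, (one_mul _).symm⟩
    have hpt : v = ![(c * v 1 - σ * v 0) * -σ, (c * v 1 - σ * v 0) * c] := by
      funext i
      fin_cases i
      · change v 0 = (c * v 1 - σ * v 0) * -σ
        linear_combination (-v 0) * hunit + c * hv
      · change v 1 = (c * v 1 - σ * v 0) * c
        linear_combination (-v 1) * hunit + σ * hv
    rw [hpt]
    refine eval_eq_zero_of_punctured _ (-σ) c (fun t ht => ?_) _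
    have hr : (t * -σ) ^ 2 + (t * c) ^ 2 = t ^ 2 := by linear_combination t ^ 2 * hunit
    have h1 := hang (t * -σ) (t * c) (by rw [hr]; exact pow_ne_zero 2 ht)
      (by rw [hr, gegenbauerForm_evalEval, hroot, mul_zero])
    rw [eval_angularDeriv] at h1
    exact (mul_eq_zero.mp h1).resolve_left ht

end Characterization

/-! ### The quasi-invariants as a free module with a perfect pairing -/

section ModuleBasis

variable {m n : ℕ} {A : PlaneConfiguration n}

theorem planeHom_comp_parameter_mem (hm : 1 ≤ m) (hn : 1 ≤ n) (hA : A.IsAm1n m) (s : ℂ[X][X]) :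
    planeHom (s.comp (parameter m n)) ∈ A.quasiInvariants :=
  (PlaneConfiguration.mem_quasiInvariants_iff hm hn hA _).mpr
    ⟨_, comp_mem_evenPart s parameter_mem, 0, Submodule.zero_mem _, by simp⟩

/-- The embedding of `ℂ[ρ][b]` in the algebra of quasi-invariants. -/
noncomputable def parameterHom (hm : 1 ≤ m) (hn : 1 ≤ n) (hA : A.IsAm1n m) :
    ℂ[X][X] →+* A.quasiInvariants :=
  (planeHom.comp (compRingHom (parameter m n))).codRestrict A.quasiInvariants
    (planeHom_comp_parameter_mem hm hn hA)

/-- The quasi-invariants as an algebra over `ℂ[ρ][b]`. Not an instance: that `b` is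
quasi-invariant depends on the hypotheses. -/
@[reducible] noncomputable def parameterAlgebra (hm : 1 ≤ m) (hn : 1 ≤ n) (hA : A.IsAm1n m) :
    Algebra ℂ[X][X] A.quasiInvariants :=
  (parameterHom hm hn hA).toAlgebra

theorem coe_parameterAlgebra_smul (hm : 1 ≤ m) (hn : 1 ≤ n) (hA : A.IsAm1n m) (s : ℂ[X][X])
    (p : A.quasiInvariants) :
    letI := parameterAlgebra hm hn hA
    ((s • p : A.quasiInvariants) : MvPolynomial (Fin 2) ℂ) =
      planeHom (s.comp (parameter m n)) * p := rfl

/-- The decomposition of a quasi-invariant in an even and an odd part is unique. -/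
theorem eq_zero_of_planeHom_add_eq_zero {g h : ℂ[X][X]}
    (hp : planeHom g + MvPolynomial.X 0 ^ (2 * m + 1) * planeHom h = 0) : g = 0 ∧ h = 0 := by
  have h1 := planeHom_add_eq_zero (g := g) (h := (C X - X ^ 2) ^ m * h) (by
    rw [map_mul, map_pow, planeHom_C_X_sub_X_sq, ← hp]; ring)
  refine ⟨h1.1, (mul_eq_zero.mp h1.2).resolve_left (pow_ne_zero _ ?_)⟩
  rw [← neg_ne_zero, neg_sub]
  exact (monic_X_pow_sub_C (X : ℂ[X]) two_ne_zero).ne_zero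

/-- The generators of the quasi-invariants over `ℂ[ρ][b]`: the even ones come from the basis of
`evenPart`, the odd ones are `x₁^(2m+1)` times the basis of `oddPart`. -/
noncomputable def quasiInvariantGenerator (m n : ℕ) :
    Fin (n + 1) ⊕ Fin (n + 1) → MvPolynomial (Fin 2) ℂ :=
  Sum.elim (fun i => planeHom (evenBasis m n i))
    fun i => MvPolynomial.X 0 ^ (2 * m + 1) * planeHom (oddBasis m n i)

/-- The degrees of the generators in `x₁, x₂`. -/
def generatorDegree (m n : ℕ) : Fin (n + 1) ⊕ Fin (n + 1) → ℕ :=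
  Sum.elim (evenDegree n) fun i => 2 * m + 1 + oddDegree n i

theorem quasiInvariantGenerator_mem (hm : 1 ≤ m) (hn : 1 ≤ n) (hA : A.IsAm1n m)
    (l : Fin (n + 1) ⊕ Fin (n + 1)) : quasiInvariantGenerator m n l ∈ A.quasiInvariants := by
  rw [PlaneConfiguration.mem_quasiInvariants_iff hm hn hA]
  rcases l with i | i
  · exact ⟨_, evenBasis_mem i, 0, Submodule.zero_mem _, by simp [quasiInvariantGenerator]⟩
  · exact ⟨0, Submodule.zero_mem _, _, oddBasis_mem i, by simp [quasiInvariantGenerator]⟩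

theorem quasiInvariantGenerator_isHomogeneous (hn : 1 ≤ n) (l : Fin (n + 1) ⊕ Fin (n + 1)) :
    (quasiInvariantGenerator m n l).IsHomogeneous (generatorDegree m n l) := by
  rcases l with i | i
  · exact planeHom_isHomogeneous (evenBasis_hasWeight i)
  · exact (MvPolynomial.isHomogeneous_X_pow 0 _).mul
      (planeHom_isHomogeneous (oddBasis_hasWeight hn i))

theorem sum_planeHom_comp_mul (s : Fin (n + 1) ⊕ Fin (n + 1) → ℂ[X][X]) :
    ∑ l, planeHom ((s l).comp (parameter m n)) * quasiInvariantGenerator m n l =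
      planeHom (∑ i, (s (.inl i)).comp (parameter m n) * evenBasis m n i) +
        MvPolynomial.X 0 ^ (2 * m + 1) *
          planeHom (∑ i, (s (.inr i)).comp (parameter m n) * oddBasis m n i) := by
  rw [Fintype.sum_sum_type, map_sum, map_sum, Finset.mul_sum]
  congr 1 <;> refine Finset.sum_congr rfl fun i _ => ?_
  · rw [map_mul]; rfl
  · rw [map_mul]
    change _ * (_ * _) = _
    ring

theorem natDegree_parameter_ne_zero (hm : 1 ≤ m) (hn : 1 ≤ n) : (parameter m n).natDegree ≠ 0 := by
  rw [natDegree_parameter hm hn]; omega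

theorem evenBasis_injective (hm : 1 ≤ m) (hn : 1 ≤ n) (i j : Fin (n + 1))
    (h : (evenBasis m n i).natDegree ≡ (evenBasis m n j).natDegree
      [MOD (parameter m n).natDegree]) : i = j := by
  rw [natDegree_evenBasis hm hn, natDegree_evenBasis hm hn, natDegree_parameter hm hn] at h
  exact eq_of_evenDegree_modEq i j h

theorem oddBasis_injective (hm : 1 ≤ m) (hn : 1 ≤ n) (i j : Fin (n + 1))
    (h : (oddBasis m n i).natDegree ≡ (oddBasis m n j).natDegree
      [MOD (parameter m n).natDegree]) : i = j := by
  rw [natDegree_oddBasis hm hn, natDegree_oddBasis hm hn, natDegree_parameter hm hn] at h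
  exact eq_of_oddDegree_modEq i j h

theorem exists_eq_sum_evenBasis (hm : 1 ≤ m) (hn : 1 ≤ n) {g : ℂ[X][X]} (hg : g ∈ evenPart m n) :
    ∃ s : Fin (n + 1) → ℂ[X][X], g = ∑ i, (s i).comp (parameter m n) * evenBasis m n i :=
  exists_eq_sum_comp_mul (evenPart m n) (parameter_monic hm hn)
    (fun _ hp => mul_mem_evenPart parameter_mem hp) (evenBasis_monic hm hn) evenBasis_mem
    (fun _ hp _ => by
      simp only [natDegree_parameter hm hn, natDegree_evenBasis hm hn]
      exact exists_evenDegree hm hn hp) hg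

theorem exists_eq_sum_oddBasis (hm : 1 ≤ m) (hn : 1 ≤ n) {h : ℂ[X][X]} (hh : h ∈ oddPart m n) :
    ∃ s : Fin (n + 1) → ℂ[X][X], h = ∑ i, (s i).comp (parameter m n) * oddBasis m n i :=
  exists_eq_sum_comp_mul (oddPart m n) (parameter_monic hm hn)
    (fun _ hp => mul_mem_oddPart parameter_mem hp) (oddBasis_monic hm hn) oddBasis_mem
    (fun _ hp h0 => by
      simp only [natDegree_parameter hm hn, natDegree_oddBasis hm hn]
      exact exists_oddDegree hm hn hp h0) hh

/-- The generators as a basis over `ℂ[ρ][b]`. -/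
noncomputable def quasiInvariantBasis (hm : 1 ≤ m) (hn : 1 ≤ n) (hA : A.IsAm1n m) :
    letI := parameterAlgebra hm hn hA
    Module.Basis (Fin (n + 1) ⊕ Fin (n + 1)) ℂ[X][X] A.quasiInvariants :=
  letI := parameterAlgebra hm hn hA
  Module.Basis.mk (v := fun l => ⟨quasiInvariantGenerator m n l,
      quasiInvariantGenerator_mem hm hn hA l⟩)
    (Fintype.linearIndependent_iff.mpr fun s hs => by
      have h1 := congrArg (Subtype.val) hs
      rw [AddSubmonoidClass.coe_finsetSum] at h1
      change ∑ l, planeHom ((s l).comp (parameter m n)) * quasiInvariantGenerator m n l = 0 at h1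
      rw [sum_planeHom_comp_mul] at h1
      obtain ⟨h2, h3⟩ := eq_zero_of_planeHom_add_eq_zero h1
      have h4 := eq_zero_of_sum_comp_mul_eq_zero (s := fun i => s (.inl i))
        (evenBasis_monic hm hn) (natDegree_parameter_ne_zero hm hn) (evenBasis_injective hm hn) h2
      have h5 := eq_zero_of_sum_comp_mul_eq_zero (s := fun i => s (.inr i))
        (oddBasis_monic hm hn) (natDegree_parameter_ne_zero hm hn) (oddBasis_injective hm hn) h3
      rintro (i | i)
      · exact congrFun h4 i
      · exact congrFun h5 i)
    (by
      rintro ⟨p, hp⟩ -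
      obtain ⟨g, hg, h, hh, rfl⟩ := (PlaneConfiguration.mem_quasiInvariants_iff hm hn hA p).mp hp
      obtain ⟨s, rfl⟩ := exists_eq_sum_evenBasis hm hn hg
      obtain ⟨t, rfl⟩ := exists_eq_sum_oddBasis hm hn hh
      refine (Submodule.mem_span_range_iff_exists_fun _).mpr ⟨Sum.elim s t, Subtype.ext ?_⟩
      rw [AddSubmonoidClass.coe_finsetSum]
      exact sum_planeHom_comp_mul (Sum.elim s t))

theorem coe_quasiInvariantBasis (hm : 1 ≤ m) (hn : 1 ≤ n) (hA : A.IsAm1n m)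
    (l : Fin (n + 1) ⊕ Fin (n + 1)) :
    letI := parameterAlgebra hm hn hA
    (quasiInvariantBasis hm hn hA l : MvPolynomial (Fin 2) ℂ) = quasiInvariantGenerator m n l := by
  simp [quasiInvariantBasis]

/-- The coordinates of a quasi-invariant `g + x₁^(2m+1) h` at the odd generators are those of
`h`. -/
theorem eq_sum_repr_inr (hm : 1 ≤ m) (hn : 1 ≤ n) (hA : A.IsAm1n m) (p : A.quasiInvariants)
    {g h : ℂ[X][X]} (hp : (p : MvPolynomial (Fin 2) ℂ) =
      planeHom g + MvPolynomial.X 0 ^ (2 * m + 1) * planeHom h) :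
    letI := parameterAlgebra hm hn hA
    ∑ i, ((quasiInvariantBasis hm hn hA).repr p (.inr i)).comp (parameter m n) * oddBasis m n i =
      h := by
  let _ := parameterAlgebra hm hn hA
  have h1 := congrArg Subtype.val ((quasiInvariantBasis hm hn hA).sum_repr p)
  rw [AddSubmonoidClass.coe_finsetSum] at h1
  simp only [coe_parameterAlgebra_smul, coe_quasiInvariantBasis] at h1
  rw [sum_planeHom_comp_mul, hp, ← sub_eq_zero, add_sub_add_comm, ← mul_sub, ← map_sub,
    ← map_sub] at h1
  exact sub_eq_zero.mp (eq_zero_of_planeHom_add_eq_zero h1).2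

/-- The coordinate at the odd generator of top degree is a Frobenius form. The odd part of the
product of the `i`-th even and the `j`-th odd generator is monic in `X`, of the top degree `3n` for
`i = j` and of smaller degree for `i < j`, so the Gram matrix is unitriangular by blocks. -/
theorem quasiInvariants_isGorensteinRing (hm : 1 ≤ m) (hn : 1 ≤ n) (hA : A.IsAm1n m) :
    IsGorensteinRing A.quasiInvariants := by
  let _ := parameterAlgebra hm hn hA
  let u := quasiInvariantBasis hm hn hA
  have hfree : Module.Free ℂ[X][X] A.quasiInvariants := Module.Free.of_basis u
  have hfin : Module.Finite ℂ[X][X] A.quasiInvariants := Module.Finite.of_basis u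
  have hodd := oddBasis_monic (m := m) hm hn
  have hzero : ∀ (p : A.quasiInvariants) (g : ℂ[X][X]),
      (p : MvPolynomial (Fin 2) ℂ) = planeHom g → u.coord (.inr 0) p = 0 := fun p g hp => by
    have h1 := eq_sum_repr_inr hm hn hA p (g := g) (h := 0) (by rw [hp]; simp)
    exact congrFun (eq_zero_of_sum_comp_mul_eq_zero hodd (natDegree_parameter_ne_zero hm hn)
      (oddBasis_injective hm hn) h1) 0
  have hmul : ∀ i j, ((u (.inl i) * u (.inr j) : A.quasiInvariants) : MvPolynomial (Fin 2) ℂ) =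
      planeHom 0 + MvPolynomial.X 0 ^ (2 * m + 1) *
        planeHom (evenBasis m n i * oddBasis m n j) := fun i j => by
    rw [MulMemClass.coe_mul, coe_quasiInvariantBasis, coe_quasiInvariantBasis, map_zero, zero_add,
      map_mul]
    change planeHom (evenBasis m n i) * (_ * planeHom (oddBasis m n j)) = _
    ring
  have hmon : ∀ i j, (evenBasis m n i * oddBasis m n j).Monic := fun i j =>
    (evenBasis_monic hm hn i).mul (hodd j)
  have hdeg : ∀ i j, (evenBasis m n i * oddBasis m n j).natDegree =
      evenDegree n i + oddDegree n j := fun i j => by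
    rw [(evenBasis_monic hm hn i).natDegree_mul (hodd j), natDegree_evenBasis hm hn,
      natDegree_oddBasis hm hn]
  have htop : oddDegree n 0 = 3 * n := by
    rw [← evenDegree_add_oddDegree (0 : Fin (n + 1)), evenDegree]; simp
  refine isGorensteinRing_of_frobenius (u.coord (.inr 0))
    (bijective_comp_mulLeft u _ (fun i j => ?_) (fun i j => ?_) (fun i j hij => ?_) fun i => ?_)
  · refine hzero _ (evenBasis m n i * evenBasis m n j) ?_
    rw [MulMemClass.coe_mul, coe_quasiInvariantBasis, coe_quasiInvariantBasis, map_mul]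
    rfl
  · refine hzero _ ((C X - X ^ 2) ^ (2 * m + 1) * (oddBasis m n i * oddBasis m n j)) ?_
    rw [MulMemClass.coe_mul, coe_quasiInvariantBasis, coe_quasiInvariantBasis, map_mul, map_mul,
      map_pow, planeHom_C_X_sub_X_sq]
    change (_ * _) * (_ * _) = _
    ring
  · refine coeff_eq_zero_of_degree_sum_lt hodd (natDegree_parameter_ne_zero hm hn)
      (oddBasis_injective hm hn) (fun l => u.repr (u (.inl i) * u (.inr j)) (.inr l)) 0 ?_
    rw [eq_sum_repr_inr hm hn hA _ (hmul i j), degree_eq_natDegree (hmon i j).ne_zero, hdeg,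
      natDegree_oddBasis hm hn, htop, ← evenDegree_add_oddDegree j]
    exact_mod_cast Nat.add_lt_add_right (evenDegree_lt hij) _
  · refine coeff_eq_one_of_monic_sum hodd (natDegree_parameter_ne_zero hm hn)
      (oddBasis_injective hm hn) (fun l => u.repr (u (.inl i) * u (.inr i)) (.inr l)) 0 ?_ ?_
    · rw [eq_sum_repr_inr hm hn hA _ (hmul i i)]
      exact hmon i i
    · rw [eq_sum_repr_inr hm hn hA _ (hmul i i), hdeg, natDegree_oddBasis hm hn, htop,
        evenDegree_add_oddDegree]

end ModuleBasis

/-! ### Counting series and homogeneous bases -/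

section Count

/-- The generating series counting the elements of a type by a degree with finite fibres. -/
noncomputable def degreeSeries {I : Type*} (d : I → ℕ) : PowerSeries ℚ :=
  PowerSeries.mk fun k => (Nat.card {i // d i = k} : ℚ)

theorem degreeSeries_congr {I J : Type*} (e : I ≃ J) {d : I → ℕ} {d' : J → ℕ}
    (h : ∀ i, d' (e i) = d i) : degreeSeries d = degreeSeries d' := by
  ext k
  rw [degreeSeries, degreeSeries, PowerSeries.coeff_mk, PowerSeries.coeff_mk,
    Nat.card_congr (e.subtypeEquiv (q := fun j => d' j = k) fun i => by rw [h])]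

theorem degreeSeries_eq_sum {I : Type*} [Fintype I] (d : I → ℕ) :
    degreeSeries d = ∑ i, PowerSeries.X ^ d i := by
  classical
  ext k
  rw [degreeSeries, PowerSeries.coeff_mk, map_sum]
  simp only [PowerSeries.coeff_X_pow]
  rw [Finset.sum_boole, Nat.card_eq_fintype_card, Fintype.card_subtype]
  simp only [eq_comm]

theorem finite_prod_nat {I : Type*} {d : I → ℕ} (hd : ∀ k, Finite {i // d i = k}) {c : ℕ}
    (hc : 1 ≤ c) (k : ℕ) : Finite {x : I × ℕ // d x.1 + c * x.2 = k} := by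
  have := fun j : Fin (k + 1) => hd (k - c * j)
  let f : {x : I × ℕ // d x.1 + c * x.2 = k} → (j : Fin (k + 1)) × {i // d i = k - c * j} :=
    fun x => ⟨⟨x.1.2, by have := x.2; have := Nat.le_mul_of_pos_left x.1.2 hc; omega⟩,
      x.1.1, by have := x.2; simp only; omega⟩
  refine Finite.of_injective f fun x y hxy => ?_
  obtain ⟨⟨i, j⟩, hx⟩ := x
  obtain ⟨⟨i', j'⟩, hy⟩ := y
  simp only [f, Sigma.mk.injEq, Fin.mk.injEq] at hxy
  obtain ⟨rfl, h⟩ := hxy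
  simp at h
  simp [h]

/-- Adjoining a variable of degree `c` divides the series by `1 - X ^ c`. -/
theorem degreeSeries_prod_nat {I : Type*} {d : I → ℕ} (hd : ∀ k, Finite {i // d i = k}) {c : ℕ}
    (hc : 1 ≤ c) :
    degreeSeries (fun x : I × ℕ => d x.1 + c * x.2) * (1 - PowerSeries.X ^ c) =
      degreeSeries d := by
  have hfin := finite_prod_nat hd hc
  ext k
  rw [mul_sub, mul_one, map_sub, PowerSeries.coeff_mul_X_pow']
  simp only [degreeSeries, PowerSeries.coeff_mk]
  have hsplit : Nat.card {x : I × ℕ // d x.1 + c * x.2 = k} = Nat.card {i // d i = k} +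
      Nat.card {x : I × ℕ // d x.1 + c * x.2 + c = k} := by
    have hfin' : Finite {x : I × ℕ // d x.1 + c * x.2 + c = k} := by
      refine Finite.of_injective
        (β := {x : I × ℕ // d x.1 + c * x.2 = k - c}) (fun x => ⟨x.1, by have := x.2; omega⟩)
        fun x y h => Subtype.ext (by simpa using h)
    have := hd k
    rw [← Nat.card_sum]
    refine Nat.card_congr (Equiv.ofBijective (Sum.elim
      (fun i => ⟨(i.1, 0), by have := i.2; simpa using this⟩)
      fun x => ⟨(x.1.1, x.1.2 + 1), by have := x.2; simp only [mul_add]; omega⟩) ?_).symm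
    constructor
    · rintro (⟨i, hi⟩ | ⟨⟨i, j⟩, hx⟩) (⟨i', hi'⟩ | ⟨⟨i', j'⟩, hx'⟩) h <;> simp at h ⊢
      · exact h
      · exact h
    · rintro ⟨⟨i, j⟩, h⟩
      cases j with
      | zero => exact ⟨.inl ⟨i, by simpa using h⟩, rfl⟩
      | succ j => exact ⟨.inr ⟨(i, j), by simp only [mul_add] at h ⊢; omega⟩, rfl⟩
  rw [hsplit]
  split_ifs with hk
  · rw [Nat.card_congr (Equiv.subtypeEquivRight fun x : I × ℕ =>
      show d x.1 + c * x.2 + c = k ↔ d x.1 + c * x.2 = k - c by omega)]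
    push_cast; ring
  · have : IsEmpty {x : I × ℕ // d x.1 + c * x.2 + c = k} := ⟨fun x => by have := x.2; omega⟩
    rw [Nat.card_of_isEmpty (α := {x : I × ℕ // d x.1 + c * x.2 + c = k})]
    simp

/-- The dimension of a graded piece of a subspace with a homogeneous basis. -/
theorem finrank_inf_homogeneousSubmodule {K σ I : Type*} [Field K]
    (Q : Submodule K (MvPolynomial σ K)) (v : Module.Basis I K Q) (d : I → ℕ)
    (hv : ∀ i, (v i : MvPolynomial σ K).IsHomogeneous (d i)) (k : ℕ) :
    Module.finrank K ↥(Q ⊓ MvPolynomial.homogeneousSubmodule σ K k) = Nat.card {i // d i = k} := by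
  classical
  let w : {i // d i = k} → MvPolynomial σ K := fun i => v i
  have hw : LinearIndependent K w :=
    (v.linearIndependent.map' Q.subtype Q.ker_subtype).comp _ Subtype.val_injective
  have hspan : Submodule.span K (Set.range w) = Q ⊓ MvPolynomial.homogeneousSubmodule σ K k := by
    refine le_antisymm (Submodule.span_le.mpr ?_) ?_
    · rintro _ ⟨i, rfl⟩
      exact ⟨(v i).2, by rw [← i.2]; exact hv i⟩
    · rintro p ⟨hp, hk⟩
      have h1 := congrArg Subtype.val (v.linearCombination_repr ⟨p, hp⟩)
      rw [Finsupp.linearCombination_apply, Finsupp.sum, AddSubmonoidClass.coe_finsetSum] at h1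
      have h2 := congrArg (MvPolynomial.homogeneousComponent k) h1
      rw [map_sum] at h2
      change _ = MvPolynomial.homogeneousComponent k p at h2
      rw [MvPolynomial.homogeneousComponent_of_mem hk, if_pos rfl] at h2
      rw [← h2]
      refine Submodule.sum_mem _ fun i _ => ?_
      rw [Submodule.coe_smul, map_smul, MvPolynomial.homogeneousComponent_of_mem (hv i)]
      split_ifs with h
      · exact Submodule.smul_mem _ _ (Submodule.subset_span ⟨⟨i, h.symm⟩, rfl⟩)
      · rw [smul_zero]; exact Submodule.zero_mem _
  rw [← hspan]
  exact Module.finrank_eq_nat_card_basis (Module.Basis.span hw)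

end Count

/-! ### The Hilbert series -/

section HilbertSeries

variable {m n : ℕ} {A : PlaneConfiguration n}

theorem parameter_hasWeight : HasWeight (parameter m n) (n + 1) := evenElement_hasWeight le_rfl

/-- The Hilbert series counts the products `ρʲ bᵏ u` with `u` one of the generators. -/
theorem hilbertSeries_eq_degreeSeries (hm : 1 ≤ m) (hn : 1 ≤ n) (hA : A.IsAm1n m) :
    A.hilbertSeries = degreeSeries fun x : ((Fin (n + 1) ⊕ Fin (n + 1)) × ℕ) × ℕ =>
      generatorDegree m n x.1.1 + 2 * x.1.2 + (n + 1) * x.2 := by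
  let _ := parameterAlgebra hm hn hA
  have : IsScalarTower ℂ ℂ[X][X] A.quasiInvariants := IsScalarTower.of_algebraMap_eq fun a => by
    refine Subtype.ext ?_
    change MvPolynomial.C a = planeHom ((C (C a)).comp (parameter m n))
    rw [C_comp, planeHom_C_C]
  let v := (((basisMonomials ℂ).smulTower (basisMonomials ℂ[X])).smulTower
    (quasiInvariantBasis hm hn hA))
  have hv : ∀ x, (v x : MvPolynomial (Fin 2) ℂ).IsHomogeneous
      (generatorDegree m n x.2 + 2 * x.1.1 + (n + 1) * x.1.2) := by
    rintro ⟨⟨i, j⟩, l⟩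
    have h1 : (v ((i, j), l) : MvPolynomial (Fin 2) ℂ) =
        planeHom (C X) ^ i * planeHom (parameter m n) ^ j * quasiInvariantGenerator m n l := by
      rw [Module.Basis.smulTower_apply, coe_parameterAlgebra_smul, coe_quasiInvariantBasis,
        Module.Basis.smulTower_apply, coe_basisMonomials, coe_basisMonomials]
      simp only [monomial_one_right_eq_X_pow, smul_eq_C_mul, mul_comp, map_mul, map_pow,
        pow_comp, C_comp, X_comp]
    rw [h1, planeHom_C_X]
    have h2 := ((((MvPolynomial.isHomogeneous_X_pow (R := ℂ) (0 : Fin 2) 2).add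
      (MvPolynomial.isHomogeneous_X_pow 1 2)).pow i).mul
      ((planeHom_isHomogeneous (parameter_hasWeight (m := m) (n := n))).pow j)).mul
      (quasiInvariantGenerator_isHomogeneous (m := m) hn l)
    convert h2 using 1
    ring
  rw [← degreeSeries_congr
    ((Equiv.prodComm (ℕ × ℕ) _).trans (Equiv.prodAssoc _ ℕ ℕ).symm)
    (d := fun x => generatorDegree m n x.2 + 2 * x.1.1 + (n + 1) * x.1.2) fun _ => rfl]
  ext k
  rw [PlaneConfiguration.hilbertSeries, degreeSeries, PowerSeries.coeff_mk, PowerSeries.coeff_mk]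
  exact congrArg Nat.cast
    (finrank_inf_homogeneousSubmodule (Subalgebra.toSubmodule A.quasiInvariants) v _ hv k)

/-- The degrees of the generators are `0`, `2m + 1 + 3n` and two arithmetic progressions of length
`n`. -/
theorem sum_X_pow_generatorDegree_mul (hn : 1 ≤ n) :
    (∑ l, (PowerSeries.X : PowerSeries ℚ) ^ generatorDegree m n l) * (1 - PowerSeries.X) =
      (1 - PowerSeries.X) + PowerSeries.X ^ (n + 2) * (1 - PowerSeries.X ^ n) +
        PowerSeries.X ^ (2 * m + 1 + 3 * n) * (1 - PowerSeries.X) +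
        PowerSeries.X ^ (2 * m + n) * (1 - PowerSeries.X ^ n) := by
  have hgeom : (1 - PowerSeries.X ^ n : PowerSeries ℚ) =
      (∑ i : Fin n, (PowerSeries.X : PowerSeries ℚ) ^ (i : ℕ)) * (1 - PowerSeries.X) := by
    rw [Fin.sum_univ_eq_sum_range (fun i => (PowerSeries.X : PowerSeries ℚ) ^ i), mul_comm,
      mul_neg_geom_sum]
  have hodd : ∑ i : Fin n, (PowerSeries.X : PowerSeries ℚ) ^ (2 * m + 1 + oddDegree n i.succ) =
      PowerSeries.X ^ (2 * m + n) * ∑ i : Fin n, (PowerSeries.X : PowerSeries ℚ) ^ (i : ℕ) := by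
    rw [Finset.mul_sum, ← Equiv.sum_comp Fin.revPerm]
    refine Finset.sum_congr rfl fun i _ => ?_
    rw [← pow_add]
    congr 1
    have := i.isLt
    rw [oddDegree, evenDegree, if_neg (by simp), Fin.revPerm_apply, Fin.val_succ, Fin.val_rev]
    omega
  have heven : ∑ i : Fin n, (PowerSeries.X : PowerSeries ℚ) ^ evenDegree n i.succ =
      PowerSeries.X ^ (n + 2) * ∑ i : Fin n, (PowerSeries.X : PowerSeries ℚ) ^ (i : ℕ) := by
    rw [Finset.mul_sum]
    refine Finset.sum_congr rfl fun i _ => ?_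
    rw [← pow_add, evenDegree, if_neg (by simp), Fin.val_succ]
    congr 1
    omega
  rw [Fintype.sum_sum_type, Fin.sum_univ_succ, Fin.sum_univ_succ]
  simp only [generatorDegree, Sum.elim_inl, Sum.elim_inr]
  rw [hodd, heven, hgeom, oddDegree, evenDegree, if_pos (by simp), Nat.sub_zero]
  ring

theorem hilbertSeries_mul (hm : 1 ≤ m) (hn : 1 ≤ n) (hA : A.IsAm1n m) :
    A.hilbertSeries * (PowerSeries.X ^ 2 - 1) ^ 2 =
      1 - PowerSeries.X ^ 2 + PowerSeries.X ^ (n + 1) + PowerSeries.X ^ (n + 2)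
        + PowerSeries.X ^ (2 * m + n) + PowerSeries.X ^ (2 * m + n + 1)
        - PowerSeries.X ^ (2 * m + 2 * n) + PowerSeries.X ^ (2 * m + 2 * n + 2) := by
  have hfin0 : ∀ k, Finite {l // generatorDegree m n l = k} := fun k => inferInstance
  have h1 := degreeSeries_prod_nat hfin0 (c := 2) one_le_two
  have h2 := degreeSeries_prod_nat (finite_prod_nat hfin0 (c := 2) one_le_two) (c := n + 1)
    (Nat.le_add_left 1 n)
  rw [← hilbertSeries_eq_degreeSeries hm hn hA] at h2
  rw [← h2, degreeSeries_eq_sum] at h1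
  have h3 := sum_X_pow_generatorDegree_mul (m := m) hn
  rw [← h1] at h3
  have hne : (1 - PowerSeries.X ^ (n + 1) : PowerSeries ℚ) ≠ 0 := fun h => by
    have := congrArg PowerSeries.constantCoeff h
    simp at this
  refine mul_right_cancel₀ hne ?_
  linear_combination (1 + PowerSeries.X) * h3

theorem hasPalindromicHilbertSeries (hm : 1 ≤ m) (hn : 1 ≤ n) (hA : A.IsAm1n m) :
    A.HasPalindromicHilbertSeries := by
  let N : ℚ[X] := 1 - X ^ 2 + X ^ (n + 1) + X ^ (n + 2) + X ^ (2 * m + n) + X ^ (2 * m + n + 1)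
    - X ^ (2 * m + 2 * n) + X ^ (2 * m + 2 * n + 2)
  let D : ℚ[X] := (X ^ 2 - 1) ^ 2
  have hD : D ≠ 0 := pow_ne_zero _ (X_pow_sub_C_ne_zero two_pos 1)
  let P : RatFunc ℚ := algebraMap ℚ[X] (RatFunc ℚ) N / algebraMap ℚ[X] (RatFunc ℚ) D
  have hcross : P.num * D = N * P.denom := by
    have h1 := RatFunc.num_div_denom P
    rw [div_eq_div_iff (RatFunc.algebraMap_ne_zero P.denom_ne_zero) (RatFunc.algebraMap_ne_zero hD),
      ← map_mul, ← map_mul] at h1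
    exact RatFunc.algebraMap_injective ℚ h1
  have hX0 : (RatFunc.X : RatFunc ℚ) ≠ 0 := RatFunc.X_ne_zero
  have hX2 : (RatFunc.X : RatFunc ℚ) ^ 2 - 1 ≠ 0 := by
    have := RatFunc.algebraMap_ne_zero (X_pow_sub_C_ne_zero (R := ℚ) two_pos 1)
    rwa [map_sub, map_pow, RatFunc.algebraMap_X, C_1, map_one] at this
  have hDx : D.eval₂ RatFunc.C (RatFunc.X : RatFunc ℚ)⁻¹ =
      (RatFunc.X ^ 2 - 1) ^ 2 / RatFunc.X ^ 4 := by
    simp only [D, eval₂_pow, eval₂_sub, eval₂_X, eval₂_one]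
    field_simp
    ring
  have hD0 : D.eval₂ RatFunc.C (RatFunc.X : RatFunc ℚ)⁻¹ ≠ 0 := by
    rw [hDx]
    exact div_ne_zero (pow_ne_zero _ hX2) (pow_ne_zero _ hX0)
  have hP0 : P.denom.eval₂ RatFunc.C (RatFunc.X : RatFunc ℚ)⁻¹ ≠ 0 := fun h => by
    obtain ⟨q, hq⟩ := RatFunc.denom_div_dvd N D
    refine hD0 ?_
    rw [hq, eval₂_mul]
    exact mul_eq_zero_of_left h _
  -- The exponents of `N` are symmetric under `a ↦ 2m + 2n + 2 - a`, those of `D` under `a ↦ 4 - a`.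
  refine ⟨P, ?_, 2 - 2 * m - 2 * n, ?_⟩
  · have h1 := hilbertSeries_mul hm hn hA
    have hDne : (D : PowerSeries ℚ) ≠ 0 := by
      rwa [Ne, Polynomial.coe_eq_zero_iff]
    have h2 := congrArg (fun p : ℚ[X] => (p : PowerSeries ℚ)) hcross
    simp only [Polynomial.coe_mul] at h2
    refine mul_right_cancel₀ hDne ?_
    rw [h2, mul_right_comm]
    congr 1
    simpa [N, D] using h1
  · have h1 := congrArg (eval₂ RatFunc.C (RatFunc.X : RatFunc ℚ)⁻¹) hcross
    rw [eval₂_mul, eval₂_mul] at h1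
    rw [RatFunc.eval, div_eq_iff hP0, ← mul_left_inj' hD0, h1, mul_right_comm]
    congr 1
    have hNx : N.eval₂ RatFunc.C (RatFunc.X : RatFunc ℚ)⁻¹ * RatFunc.X ^ (2 * m + 2 * n + 2) =
        algebraMap ℚ[X] (RatFunc ℚ) N := by
      have hpow : ∀ a b : ℕ, a + b = 2 * m + 2 * n + 2 →
          (RatFunc.X : RatFunc ℚ)⁻¹ ^ a * RatFunc.X ^ (2 * m + 2 * n + 2) = RatFunc.X ^ b :=
        fun a b h => by
          rw [← h, pow_add, ← mul_assoc, inv_pow, inv_mul_cancel₀ (pow_ne_zero _ hX0), one_mul]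
      simp only [N, eval₂_add, eval₂_sub, eval₂_pow, eval₂_X, eval₂_one, map_add, map_sub, map_pow,
        map_one, RatFunc.algebraMap_X, add_mul, sub_mul]
      rw [hpow 2 (2 * m + 2 * n) (by ring), hpow (n + 1) (2 * m + n + 1) (by ring),
        hpow (n + 2) (2 * m + n) (by ring), hpow (2 * m + n) (n + 2) (by ring),
        hpow (2 * m + n + 1) (n + 1) (by ring), hpow (2 * m + 2 * n) 2 (by ring),
        hpow (2 * m + 2 * n + 2) 0 (by ring)]
      ring
    have hz : (RatFunc.X : RatFunc ℚ) ^ (2 - 2 * m - 2 * n : ℤ) * RatFunc.X ^ (2 * m + 2 * n + 2) =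
        RatFunc.X ^ 4 := by
      rw [← zpow_natCast, ← zpow_natCast, ← zpow_add₀ hX0]
      congr 1
      push_cast; ring
    have hDa : algebraMap ℚ[X] (RatFunc ℚ) D = (RatFunc.X ^ 2 - 1) ^ 2 := by
      simp [D, RatFunc.algebraMap_X]
    rw [hDx, ← mul_left_inj' (pow_ne_zero (2 * m + 2 * n + 2) hX0), hNx,
      mul_right_comm _ _ (RatFunc.X ^ (2 * m + 2 * n + 2)), mul_right_comm _ P, hz]
    simp only [P, hDa]
    field_simp

end HilbertSeries

end QuasiInvariants

theorem theorem5p13 (m n : ℕ) (hm : 1 ≤ m) (hn : 1 ≤ n) (A : PlaneConfiguration n)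
    (hA : A.IsAm1n m) :
    A.hilbertSeries * (PowerSeries.X ^ 2 - 1) ^ 2 =
        1 - PowerSeries.X ^ 2 + PowerSeries.X ^ (n + 1) + PowerSeries.X ^ (n + 2)
          + PowerSeries.X ^ (2 * m + n) + PowerSeries.X ^ (2 * m + n + 1)
          - PowerSeries.X ^ (2 * m + 2 * n) + PowerSeries.X ^ (2 * m + 2 * n + 2) ∧
      A.HasPalindromicHilbertSeries ∧
      IsGorensteinRing A.quasiInvariants :=
  ⟨hilbertSeries_mul hm hn hA, hasPalindromicHilbertSeries hm hn hA,
    quasiInvariants_isGorensteinRing hm hn hA⟩
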